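/- Let $H$ be a real or complex Hilbert space and let $A$ be a self-adjoint operator in $H$ with domain $D(A)$ that has a complete orthonormal system of eigenvectors $\{v_k\}_{k\ge 1}$, $Av_k=\lambda_k v_k$, with $0<\lambda_1\le\lambda_2\le\cdots\to+\infty$. Write $h_k=(h,v_k)$ for $h\in H$, $D(A^{\varepsilon})=\{h\in H:\sum_k\lambda_k^{2\varepsilon}|h_k|^2<\infty\}$ and $\|h\|_\varepsilon^2=\sum_k\lambda_k^{2\varepsilon}|h_k|^2$. Let $\rho\in(0,1)$, $\gamma>0$, $T>0$, let $$D_t^{\rho}h(t)=\frac{1}{\Gamma(1-\rho)}\int_0^t\frac{h'(\xi)}{(t-\xi)^{\rho}}\,d\xi$$ be the Caputo derivative (a Bochner integral), and for $\lambda>0$, $t\ge0$ let $$B_\rho(\lambda,t)=\frac{\gamma}{\pi}\int_0^\infty e^{-rt}\,\frac{\lambda r^{\rho}\sin\rho\pi}{(-r+\lambda\gamma r^{\rho}\cos\rho\pi+\lambda)^2+(\lambda\gamma r^{\rho}\sin\rho\pi)^2}\,dr .$$ Consider the problem $$D_tV(t)+A(1+\gamma D_t^{\rho})V(t)=f(t),\quad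 0<t\le T,\qquad V(0)=0. \tag{1}$$ A solution of (1) is a function $V\in C([0,T];H)$ such that $D_tV$, $AV$ and $AD_t^{\rho}V$ exist and belong to $C((0,T];H)$ and (1) holds; time derivatives at the end points of $[0,T]$ are one-sided. **Theorem.** Let $\varepsilon\in(0,1)$. There is a constant $C_\varepsilon>0$ (which may depend on $\varepsilon,\rho,\gamma,T$ and $A$, but not on $f$) such that for every $f\in C([0,T];D(A^{\varepsilon}))$ the problem (1) has a unique solution $V$ on $[0,T]$. It is given by $$V(t)=\sum_{k=1}^\infty\left[\int_0^tB_\rho(\lambda_k,t-\tau)f_k(\tau)\,d\tau\right]v_k,\qquad 0\le t\le T,$$ with convergence in $H$. Moreover, $V$ has a (right) derivative also at $t=0$, and with $D_t^\rho V(0)=0$ (the integral over the empty interval) $$\|D_tV(t)\|^2+\|AV(t)\|^2+\|AD_t^{\rho}V(t)\|^2\le C_\varepsilon\max_{s\in[0,T]}\|f(s)\|_\varepsilon^2,\qquad 0\le t\le T .$$ -/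

import Mathlib

open Set Filter Topology MeasureTheory

namespace RayleighStokes

/-- The kernel `B_ρ(λ, t) = (γ/π) ∫₀^∞ e^{-rt} λ r^ρ sin(ρπ) / ((-r + λγ r^ρ cos(ρπ) + λ)² + (λγ r^ρ sin(ρπ))²) dr`. -/
noncomputable def kernelB (ρ γ lam t : ℝ) : ℝ :=
  γ / Real.pi * ∫ r in Ioi (0 : ℝ), Real.exp (-r * t) *
    (lam * r ^ ρ * Real.sin (ρ * Real.pi) /
      ((-r + lam * γ * r ^ ρ * Real.cos (ρ * Real.pi) + lam) ^ 2
        + (lam * γ * r ^ ρ * Real.sin (ρ * Real.pi)) ^ 2))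

section Caputo

variable {H : Type*} [NormedAddCommGroup H] [NormedSpace ℝ H]

/-- The integrand `(t - ξ)^{-ρ} h'(ξ)` of the Caputo derivative of order `ρ` at time `t`. -/
noncomputable def caputoIntegrand (ρ : ℝ) (h : ℝ → H) (t ξ : ℝ) : H :=
  (t - ξ) ^ (-ρ) • deriv h ξ

/-- The Caputo derivative `D_t^ρ h(t) = (1/Γ(1-ρ)) ∫₀ᵗ (t - ξ)^{-ρ} h'(ξ) dξ` (Bochner integral).
It exists at `t` when `caputoIntegrand ρ h t` is integrable on `(0, t)`. -/
noncomputable def caputo (ρ : ℝ) (h : ℝ → H) (t : ℝ) : H :=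
  (Real.Gamma (1 - ρ))⁻¹ • ∫ ξ in (0 : ℝ)..t, caputoIntegrand ρ h t ξ

/-- The time derivative of a function on `[0, T]` (one-sided at the two end points). -/
noncomputable def timeDeriv (T : ℝ) (u : ℝ → H) (t : ℝ) : H :=
  derivWithin u (Icc 0 T) t

end Caputo

section Operators

variable {𝕜 : Type*} [RCLike 𝕜] {H : Type*} [NormedAddCommGroup H] [InnerProductSpace 𝕜 H]

open Classical in
/-- The value `A x` of a partially defined operator; it is only meant for `x ∈ D(A)`
(and set to `0` elsewhere). -/
noncomputable def opApply (A : H →ₗ.[𝕜] H) (x : H) : H :=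
  if hx : x ∈ A.domain then A ⟨x, hx⟩ else 0

/-- The domain `D(A^τ) = {h : ∑ λ_k^{2τ} |h_k|² < ∞}` of the fractional power `A^τ`,
where `h_k = (h, v_k)` are the Fourier coefficients in the eigenbasis `v` of `A`. -/
def fracDomain (v : HilbertBasis ℕ 𝕜 H) (lam : ℕ → ℝ) (τ : ℝ) : Set H :=
  {h | Summable fun k => lam k ^ (2 * τ) * ‖inner 𝕜 (v k) h‖ ^ 2}

/-- The norm `‖h‖_τ = (∑ λ_k^{2τ} |h_k|²)^{1/2}` of `D(A^τ)`. -/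
noncomputable def fracNorm (v : HilbertBasis ℕ 𝕜 H) (lam : ℕ → ℝ) (τ : ℝ) (h : H) : ℝ :=
  Real.sqrt (∑' k, lam k ^ (2 * τ) * ‖inner 𝕜 (v k) h‖ ^ 2)

/-- `f ∈ C([0, T]; D(A^τ))`: on `[0, T]` the function `f` takes values in `D(A^τ)` and is
continuous for the norm `‖·‖_τ`. -/
def FracContinuous (v : HilbertBasis ℕ 𝕜 H) (lam : ℕ → ℝ) (τ T : ℝ) (f : ℝ → H) : Prop :=
  (∀ t ∈ Icc 0 T, f t ∈ fracDomain v lam τ) ∧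
  ∀ s ∈ Icc 0 T, Tendsto (fun t => fracNorm v lam τ (f t - f s)) (𝓝[Icc 0 T] s) (𝓝 0)

variable [NormedSpace ℝ H]

/-- `u` is a solution on `[0, T]` of the forward problem
`D_t u + A (1 + γ D_t^ρ) u = f` for `0 < t ≤ T`, `u(0) = φ`: that is, `u ∈ C([0, T]; H)`, the
functions `D_t u`, `A u` and `A D_t^ρ u` exist and belong to `C((0, T]; H)`, and the equation
and the initial condition hold. -/
structure IsForwardSolution (A : H →ₗ.[𝕜] H) (ρ γ T : ℝ) (f : ℝ → H) (φ : H) (u : ℝ → H) :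
    Prop where
  continuousOn : ContinuousOn u (Icc 0 T)
  differentiable : ∀ t ∈ Ioc 0 T, DifferentiableWithinAt ℝ u (Icc 0 T) t
  continuousOn_timeDeriv : ContinuousOn (timeDeriv T u) (Ioc 0 T)
  mem_domain : ∀ t ∈ Ioc 0 T, u t ∈ A.domain
  continuousOn_op : ContinuousOn (fun t => opApply A (u t)) (Ioc 0 T)
  caputo_exists : ∀ t ∈ Ioc 0 T, IntervalIntegrable (caputoIntegrand ρ u t) volume 0 t
  caputo_mem_domain : ∀ t ∈ Ioc 0 T, caputo ρ u t ∈ A.domain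
  continuousOn_op_caputo : ContinuousOn (fun t => opApply A (caputo ρ u t)) (Ioc 0 T)
  equation : ∀ t ∈ Ioc 0 T, timeDeriv T u t + opApply A (u t + γ • caputo ρ u t) = f t
  initial : u 0 = φ

end Operators

end RayleighStokes

/-! In the eigenbasis, (1) splits into scalar problems `w' + λw + λγ D^ρ w = f_k`, `w(0) = 0`, whose
symbol is `p(s) = s + λγ s^ρ + λ`. Cauchy's theorem on the slit plane gives `1/p(s) = ∫ μ(r)/(r+s)
dr` with a density `μ ≥ 0` (`stieltjes_density`), and letting `s → ∞` in `s/p(s)` shows that `μ` has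
mass one. Hence `B` is the Laplace transform of `μ`, it is nonnegative with `B(0) = 1`, its own
transform is `1/p`, and `D = -B'` is nonnegative with transform `1 - s/p(s)`.

Write `g` for the kernel of the Caputo derivative, whose transform is `s^(ρ-1)`. The identity `p - s
= λ + λγ s^ρ` becomes the Volterra equation `D = λB + λγ(g - g*D)` by uniqueness of Laplace
transforms (`kernelD_eq_ae`). With associativity of convolution it shows that `z = f - D*f` is the
derivative of the solution `B*f` (`scalar_solution`).

Two bounds uniform in `λ` carry the estimate: `λB(t) ≤ γ⁻¹ t^(ρ-1)` and `λ^(-ε) D(t) ≤ c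
t^(ε(1-ρ)-1)` (`kernelB_le_rpow`, `kernelD_le_rpow`). Both singularities are integrable, so
convolution with these diagonal kernels maps continuous functions to continuous functions
(`exists_diagonal_volterra`). The first bound controls `AV` by `f`; the second, paid for by `A^ε f`,
controls `V'`; the equation then controls `A D^ρ V`.

For uniqueness, the difference of the coefficients of two solutions satisfies a homogeneous Volterra
inequality, which is a strict contraction in `L¹` with weight `e^(-μt)` for large `μ`
(`scalar_uniqueness`). -/

namespace RayleighStokes

/-! ### Stieltjes representation of the reciprocal symbol by contour integration -/

section Stieltjes

/-- The symbol `s + λγ s^ρ + λ` in the logarithmic variable `s = e^u`. -/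
noncomputable def logSymbol (ρ γ lam : ℝ) (u : ℂ) : ℂ :=
  Complex.exp u + lam * γ * Complex.exp (ρ * u) + lam

/-- The spectral density of the kernel `kernelB`. -/
noncomputable def density (ρ γ lam r : ℝ) : ℝ :=
  γ / Real.pi * (lam * r ^ ρ * Real.sin (ρ * Real.pi) /
      ((-r + lam * γ * r ^ ρ * Real.cos (ρ * Real.pi) + lam) ^ 2
        + (lam * γ * r ^ ρ * Real.sin (ρ * Real.pi)) ^ 2))

lemma kernelB_eq_integral_density (ρ γ lam t : ℝ) :
    kernelB ρ γ lam t = ∫ r in Ioi (0 : ℝ), Real.exp (-r * t) * density ρ γ lam r := by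
  rw [kernelB, ← integral_const_mul]
  congr 1 with r
  unfold density
  ring

variable {ρ γ lam : ℝ}

lemma sin_mul_pi_pos (hρ : ρ ∈ Ioo (0 : ℝ) 1) : 0 < Real.sin (ρ * Real.pi) :=
  Real.sin_pos_of_pos_of_lt_pi (mul_pos hρ.1 Real.pi_pos)
    (by nlinarith [hρ.2, Real.pi_pos])

lemma density_nonneg (hρ : ρ ∈ Ioo (0 : ℝ) 1) (hγ : 0 < γ) (hlam : 0 < lam) {r : ℝ}
    (hr : 0 < r) : 0 ≤ density ρ γ lam r := by
  have := sin_mul_pi_pos hρ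
  unfold density
  have := Real.pi_pos
  positivity

@[fun_prop]
lemma measurable_density : Measurable (density ρ γ lam) := by
  unfold density
  fun_prop

lemma logSymbol_re (u : ℂ) : (logSymbol ρ γ lam u).re =
    Real.exp u.re * Real.cos u.im + lam * γ * (Real.exp (ρ * u.re) * Real.cos (ρ * u.im)) + lam := by
  simp [logSymbol, Complex.exp_re, Complex.exp_im]

lemma logSymbol_im (u : ℂ) : (logSymbol ρ γ lam u).im =
    Real.exp u.re * Real.sin u.im + lam * γ * (Real.exp (ρ * u.re) * Real.sin (ρ * u.im)) := by
  simp [logSymbol, Complex.exp_re, Complex.exp_im]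

/-- Off the real axis both sines in the imaginary part have the sign of `Im u`, the second strictly
because `ρ < 1`; on the real axis the symbol is positive. Both edges `Im u = ±π`, the two sides of
the cut, are included. -/
lemma logSymbol_ne_zero (hρ : ρ ∈ Ioo (0 : ℝ) 1) (hγ : 0 < γ) (hlam : 0 < lam) {u : ℂ}
    (h1 : -Real.pi ≤ u.im) (h2 : u.im ≤ Real.pi) : logSymbol ρ γ lam u ≠ 0 := by
  intro h
  have hre := logSymbol_re (ρ := ρ) (γ := γ) (lam := lam) u
  have him := logSymbol_im (ρ := ρ) (γ := γ) (lam := lam) u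
  rw [h] at hre him
  simp only [Complex.zero_re, Complex.zero_im] at hre him
  have hE := Real.exp_pos u.re
  have hE' := Real.exp_pos (ρ * u.re)
  have hlg := mul_pos hlam hγ
  rcases lt_trichotomy u.im 0 with h0 | h0 | h0
  · have a1 : Real.sin u.im ≤ 0 := Real.sin_nonpos_of_nonpos_of_neg_pi_le h0.le h1
    have a2 : Real.sin (ρ * u.im) < 0 :=
      Real.sin_neg_of_neg_of_neg_pi_lt (mul_neg_of_pos_of_neg hρ.1 h0)
        (by nlinarith [hρ.1, hρ.2, Real.pi_pos])
    have a3 := mul_nonpos_of_nonneg_of_nonpos hE.le a1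
    have a4 := mul_neg_of_pos_of_neg hlg (mul_neg_of_pos_of_neg hE' a2)
    linarith
  · rw [h0] at hre
    simp only [mul_zero, Real.cos_zero, mul_one] at hre
    have := mul_pos hlg hE'
    linarith
  · have a1 : 0 ≤ Real.sin u.im := Real.sin_nonneg_of_nonneg_of_le_pi h0.le h2
    have a2 : 0 < Real.sin (ρ * u.im) :=
      Real.sin_pos_of_pos_of_lt_pi (mul_pos hρ.1 h0)
        (by nlinarith [hρ.1, hρ.2, Real.pi_pos])
    have a3 := mul_nonneg hE.le a1
    have a4 := mul_pos hlg (mul_pos hE' a2)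
    linarith

lemma differentiable_logSymbol : Differentiable ℂ (logSymbol ρ γ lam) := by
  unfold logSymbol
  fun_prop

lemma exp_add_pi (x : ℝ) : Complex.exp (x + (Real.pi : ℝ) * Complex.I) = -(Real.exp x : ℂ) := by
  rw [Complex.exp_add, Complex.exp_pi_mul_I]; simp

lemma exp_sub_pi (x : ℝ) : Complex.exp (x + ((-Real.pi : ℝ) : ℂ) * Complex.I) = -(Real.exp x : ℂ) := by
  have : (x : ℂ) + ((-Real.pi : ℝ) : ℂ) * Complex.I = x - Real.pi * Complex.I := by push_cast; ring
  rw [this, Complex.exp_sub, Complex.exp_pi_mul_I]; simp [div_neg]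

/-- The boundary values `w` and `conj w` on the two sides of the cut give the jump `2i Im w / |w|²`,
which is how the density arises. -/
lemma inv_logSymbol_sub (hρ : ρ ∈ Ioo (0 : ℝ) 1) (hγ : 0 < γ) (hlam : 0 < lam) (x : ℝ) :
    (logSymbol ρ γ lam (x + ((-Real.pi : ℝ) : ℂ) * Complex.I))⁻¹
      - (logSymbol ρ γ lam (x + (Real.pi : ℝ) * Complex.I))⁻¹
      = ((2 * Real.pi * density ρ γ lam (Real.exp x) : ℝ) : ℂ) * Complex.I := by
  have hpi := Real.pi_pos
  have hs := sin_mul_pi_pos hρ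
  set w := logSymbol ρ γ lam (x + (Real.pi : ℝ) * Complex.I) with hw
  have hwre : w.re = -Real.exp x + lam * γ * Real.exp x ^ ρ * Real.cos (ρ * Real.pi) + lam := by
    rw [hw, logSymbol_re, ← Real.exp_mul]; simp; ring_nf
  have hwim : w.im = lam * γ * Real.exp x ^ ρ * Real.sin (ρ * Real.pi) := by
    rw [hw, logSymbol_im, ← Real.exp_mul]; simp [mul_comm x ρ, mul_assoc]
  have hconj : logSymbol ρ γ lam (x + ((-Real.pi : ℝ) : ℂ) * Complex.I) = (starRingEnd ℂ) w := by
    apply Complex.ext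
    · rw [logSymbol_re, Complex.conj_re, hw, logSymbol_re]; simp
    · rw [logSymbol_im, Complex.conj_im, hw, logSymbol_im]; simp
  rw [hconj]
  have hE := Real.rpow_pos_of_pos (Real.exp_pos x) ρ
  have hn : Complex.normSq w ≠ 0 := by
    rw [Complex.normSq_apply, hwim]
    have : 0 < lam * γ * Real.exp x ^ ρ * Real.sin (ρ * Real.pi) := by positivity
    nlinarith [mul_self_nonneg w.re, mul_pos this this]
  have hn2 : (-Real.exp x + lam * γ * Real.exp x ^ ρ * Real.cos (ρ * Real.pi) + lam) ^ 2
        + (lam * γ * Real.exp x ^ ρ * Real.sin (ρ * Real.pi)) ^ 2 = Complex.normSq w := by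
    rw [Complex.normSq_apply, hwim, hwre]; ring
  have hd : density ρ γ lam (Real.exp x) = w.im / (Real.pi * Complex.normSq w) := by
    rw [density, hn2, hwim]; field_simp
  rw [hd]
  apply Complex.ext
  · simp only [Complex.sub_re, Complex.inv_re, Complex.conj_re, Complex.normSq_conj, Complex.mul_re,
      Complex.ofReal_re, Complex.ofReal_im, Complex.I_re, Complex.I_im]
    ring
  · simp only [Complex.sub_im, Complex.inv_im, Complex.conj_im, Complex.normSq_conj, Complex.mul_im,
      Complex.ofReal_re, Complex.ofReal_im, Complex.I_re, Complex.I_im]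
    field_simp
    ring

lemma tendsto_exp_mul_comap_re_atTop {c : ℝ} (hc : c < 0) :
    Tendsto (fun u : ℂ => Complex.exp (c * u)) (comap Complex.re atTop) (𝓝 0) := by
  rw [tendsto_zero_iff_norm_tendsto_zero]
  simp only [Complex.norm_exp, Complex.re_ofReal_mul]
  exact (Real.tendsto_exp_atBot.comp (tendsto_id.const_mul_atTop_of_neg hc)).comp tendsto_comap

lemma tendsto_exp_mul_comap_re_atBot {c : ℝ} (hc : 0 < c) :
    Tendsto (fun u : ℂ => Complex.exp (c * u)) (comap Complex.re atBot) (𝓝 0) := by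
  rw [tendsto_zero_iff_norm_tendsto_zero]
  simp only [Complex.norm_exp, Complex.re_ofReal_mul]
  exact (Real.tendsto_exp_atBot.comp (tendsto_id.const_mul_atBot hc)).comp tendsto_comap

lemma tendsto_inv_logSymbol_atTop (hρ : ρ ∈ Ioo (0 : ℝ) 1) :
    Tendsto (fun u => (logSymbol ρ γ lam u)⁻¹) (comap Complex.re atTop) (𝓝 0) := by
  have h1 := tendsto_exp_mul_comap_re_atTop (c := -1) (by norm_num)
  have h2 := tendsto_exp_mul_comap_re_atTop (c := ρ - 1) (by linarith [hρ.2])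
  have h3 : Tendsto (fun u : ℂ => Complex.exp ((-1 : ℝ) * u) *
      (1 + lam * γ * Complex.exp (((ρ - 1 : ℝ) : ℂ) * u) + lam * Complex.exp ((-1 : ℝ) * u))⁻¹)
      (comap Complex.re atTop) (𝓝 (0 * (1 + (lam * γ : ℂ) * 0 + (lam : ℂ) * 0)⁻¹)) :=
    h1.mul ((((tendsto_const_nhds (x := (1 : ℂ))).add (h2.const_mul _)).add (h1.const_mul _)).inv₀ (by
      simp))
  simp only [zero_mul] at h3
  refine h3.congr fun u => ?_
  rw [logSymbol]
  have e1 : Complex.exp (((ρ - 1 : ℝ) : ℂ) * u) = Complex.exp (ρ * u) * Complex.exp (-u) := by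
    rw [← Complex.exp_add]; congr 1; push_cast; ring
  have e2 : ((-1 : ℝ) : ℂ) * u = -u := by simp
  have e3 : Complex.exp u ≠ 0 := Complex.exp_ne_zero u
  rw [e1, e2, Complex.exp_neg, ← mul_inv]
  congr 1
  field_simp

lemma tendsto_logSymbol_atBot (hρ : ρ ∈ Ioo (0 : ℝ) 1) :
    Tendsto (fun u => logSymbol ρ γ lam u) (comap Complex.re atBot) (𝓝 lam) := by
  have h1 := tendsto_exp_mul_comap_re_atBot (c := 1) (by norm_num)
  have h2 := tendsto_exp_mul_comap_re_atBot (c := ρ) hρ.1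
  have := (h1.add (h2.const_mul (lam * γ : ℂ))).add (tendsto_const_nhds (x := (lam : ℂ)))
  simpa [logSymbol] using this

lemma tendsto_integral_vertical {q : ℂ → ℂ} (hq : Measurable q) {c : ℂ} {l : Filter ℝ}
    [l.IsCountablyGenerated] (h : Tendsto q (comap Complex.re l) (𝓝 c)) (a b : ℝ) :
    Tendsto (fun R : ℝ => ∫ y : ℝ in a..b, q (R + y * Complex.I)) l (𝓝 ((b - a : ℝ) * c)) := by
  have hline : ∀ y : ℝ, Tendsto (fun R : ℝ => (R : ℂ) + y * Complex.I) l (comap Complex.re l) := by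
    intro y
    rw [tendsto_comap_iff]
    refine tendsto_id.congr fun R => by simp
  have hb : ∀ᶠ R : ℝ in l, ∀ y : ℝ, ‖q (R + y * Complex.I)‖ ≤ ‖c‖ + 1 := by
    have : ∀ᶠ u in comap Complex.re l, ‖q u‖ ≤ ‖c‖ + 1 :=
      (h.norm.eventually_lt_const (lt_add_one _)).mono fun _ => le_of_lt
    rw [eventually_comap] at this
    filter_upwards [this] with R hR y
    exact hR _ (by simp)
  have := intervalIntegral.tendsto_integral_filter_of_dominated_convergence (l := l)
    (F := fun (R : ℝ) (y : ℝ) => q (R + y * Complex.I)) (f := fun _ => c) (a := a) (b := b)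
    (μ := volume) (fun _ => ‖c‖ + 1)
    (Eventually.of_forall fun R => (hq.comp (by fun_prop)).aestronglyMeasurable)
    (hb.mono fun R hR => Eventually.of_forall fun y _ => hR y) (by simp)
    (Eventually.of_forall fun y _ => h.comp (hline y))
  simpa using this

lemma logSymbol_log {s : ℝ} (hs : 0 < s) :
    logSymbol ρ γ lam (Real.log s : ℝ) = ((s + lam * γ * s ^ ρ + lam : ℝ) : ℂ) := by
  rw [logSymbol, ← Complex.ofReal_exp, Real.exp_log hs, ← Complex.ofReal_mul ρ, ← Complex.ofReal_exp,
    mul_comm ρ, Real.exp_mul, Real.exp_log hs]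
  push_cast; ring

-- Under `s = e^u` the cut plane becomes a strip, so Cauchy's theorem on a rectangle suffices.
-- Subtracting the value at `a` makes the singularity there removable, so no residue is needed.
open Complex in
lemma integral_boundary_logSymbol (hρ : ρ ∈ Ioo (0 : ℝ) 1) (hγ : 0 < γ) (hlam : 0 < lam) {a R : ℝ}
    (hR : |a| < R) (q : ℂ → ℂ) (hq : q = fun u => ((logSymbol ρ γ lam u)⁻¹ - (logSymbol ρ γ lam a)⁻¹) *
      (exp u / (exp u - exp a))) :
    (∫ x : ℝ in -R..R, q (x + (-Real.pi : ℝ) * I)) - (∫ x : ℝ in -R..R, q (x + Real.pi * I)) +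
      I • (∫ y : ℝ in -Real.pi..Real.pi, q (R + y * I)) -
      I • (∫ y : ℝ in -Real.pi..Real.pi, q ((-R : ℝ) + y * I)) = 0 := by
  have hpi := Real.pi_pos
  have hR0 : 0 < R := (abs_nonneg a).trans_lt hR
  set S : Set ℂ := uIcc (-R) R ×ℂ uIcc (-Real.pi) Real.pi with hS
  have hSmem : ∀ u, u ∈ S ↔ (-R ≤ u.re ∧ u.re ≤ R) ∧ (-Real.pi ≤ u.im ∧ u.im ≤ Real.pi) := by
    intro u
    rw [hS, mem_reProdIm, uIcc_of_le (by linarith), uIcc_of_le (by linarith)]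
    rfl
  have hSnhds : S ∈ 𝓝 (a : ℂ) := by
    have : (Ioo (-R) R ×ℂ Ioo (-Real.pi) Real.pi) ∈ 𝓝 (a : ℂ) := by
      apply (isOpen_Ioo.reProdIm isOpen_Ioo).mem_nhds
      rw [mem_reProdIm]
      have := abs_lt.1 hR
      simp [this.1, this.2, hpi]
    refine mem_of_superset this fun u hu => ?_
    rw [mem_reProdIm] at hu
    rw [hSmem]
    exact ⟨⟨hu.1.1.le, hu.1.2.le⟩, hu.2.1.le, hu.2.2.le⟩
  have hF : DifferentiableOn ℂ (fun u => (logSymbol ρ γ lam u)⁻¹) S := by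
    refine differentiable_logSymbol.differentiableOn.inv fun u hu => ?_
    rw [hSmem] at hu
    exact logSymbol_ne_zero hρ hγ hlam hu.2.1 hu.2.2
  have hexp_ne : ∀ u ∈ S, u ≠ a → exp u - exp a ≠ 0 := by
    intro u hu hua h
    rw [hSmem] at hu
    rw [sub_eq_zero, Complex.exp_eq_exp_iff_exists_int] at h
    obtain ⟨n, hn⟩ := h
    have him := congrArg Complex.im hn
    simp at him
    have hn0 : n = 0 := by
      by_contra hne
      have h1 : (1 : ℝ) ≤ |(n : ℝ)| := by exact_mod_cast Int.one_le_abs hne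
      have h2 : |u.im| ≤ Real.pi := abs_le.2 hu.2
      rw [him, abs_mul, abs_of_pos (by positivity : (0:ℝ) < 2 * Real.pi)] at h2
      nlinarith
    subst hn0
    simp at hn
    exact hua hn
  have hdexp : ∀ u ∈ S, dslope exp (a : ℂ) u ≠ 0 := by
    intro u hu
    by_cases hua : u = a
    · rw [hua, dslope_same, Complex.deriv_exp]; exact exp_ne_zero _
    · rw [dslope_of_ne _ hua, slope_def_field]
      exact div_ne_zero (hexp_ne u hu hua) (sub_ne_zero.2 hua)
  -- The left side is holomorphic on the whole rectangle, including at `a`; it agrees with `q` on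
  -- the edges, which avoid `a` because `|a| < R`.
  have hqq : ∀ u, u ≠ (a : ℂ) → exp u * dslope (fun u => (logSymbol ρ γ lam u)⁻¹) a u
      / dslope exp (a : ℂ) u = q u := by
    intro u hua
    rw [hq, dslope_of_ne _ hua, dslope_of_ne _ hua, slope_def_field, slope_def_field]
    have := sub_ne_zero.2 hua
    -- Away from the rectangle `exp u = exp a` can occur with `u ≠ a`; both sides are then quotients
    -- by zero, hence zero.
    by_cases h : exp u - exp a = 0
    · simp [h]
    · field_simp
  have key := integral_boundary_rect_eq_zero_of_differentiableOn
    (fun u => exp u * dslope (fun u => (logSymbol ρ γ lam u)⁻¹) a u / dslope exp (a : ℂ) u)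
    (⟨-R, -Real.pi⟩ : ℂ) (⟨R, Real.pi⟩ : ℂ)
    (by
      change DifferentiableOn ℂ _ S
      refine DifferentiableOn.div (DifferentiableOn.mul (by fun_prop)
        ((differentiableOn_dslope hSnhds).2 hF)) ((differentiableOn_dslope hSnhds).2 ?_) hdexp
      fun_prop)
  have hne1 : ∀ (x y : ℝ), y ≠ 0 → (x : ℂ) + y * I ≠ a := by
    intro x y hy h
    have := congrArg Complex.im h
    simp at this
    exact hy this
  have hne2 : ∀ (x y : ℝ), x ≠ a → (x : ℂ) + y * I ≠ a := by
    intro x y hy h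
    have := congrArg Complex.re h
    simp at this
    exact hy this
  have hRa : R ≠ a := fun h => by rw [h] at hR; exact absurd (le_abs_self a) (not_le.2 hR)
  have hRa' : -R ≠ a := fun h => by rw [← h, abs_neg] at hR; exact absurd (le_abs_self R) (not_le.2 hR)
  simp only [hqq _ (hne1 _ _ hpi.ne'), hqq _ (hne1 _ _ (neg_ne_zero.2 hpi.ne')), hqq _ (hne2 _ _ hRa),
    hqq _ (hne2 _ _ hRa')] at key
  exact key

lemma integral_image_exp (g : ℝ → ℝ) :
    ∫ r in Ioi (0 : ℝ), g r = ∫ x : ℝ, Real.exp x * g (Real.exp x) := by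
  have := integral_image_eq_integral_abs_deriv_smul (s := univ) MeasurableSet.univ
    (fun x _ => (Real.hasDerivAt_exp x).hasDerivWithinAt) Real.exp_injective.injOn g
  rw [image_univ, Real.range_exp] at this
  simpa [abs_of_pos (Real.exp_pos _)] using this

lemma integrableOn_image_exp (g : ℝ → ℝ) :
    IntegrableOn g (Ioi (0 : ℝ)) ↔ Integrable fun x : ℝ => Real.exp x * g (Real.exp x) := by
  have := integrableOn_image_iff_integrableOn_abs_deriv_smul (s := univ) MeasurableSet.univ
    (fun x _ => (Real.hasDerivAt_exp x).hasDerivWithinAt) Real.exp_injective.injOn g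
  rw [image_univ, Real.range_exp] at this
  simpa [abs_of_pos (Real.exp_pos _)] using this

/-- The Stieltjes representation of `1 / (s + λγ s^ρ + λ)`. -/
theorem stieltjes_density (hρ : ρ ∈ Ioo (0 : ℝ) 1) (hγ : 0 < γ) (hlam : 0 < lam) {s : ℝ}
    (hs : 0 < s) :
    IntegrableOn (fun r => density ρ γ lam r / (r + s)) (Ioi 0) ∧
    ∫ r in Ioi (0 : ℝ), density ρ γ lam r / (r + s) = (s + lam * γ * s ^ ρ + lam)⁻¹ := by
  have hpi := Real.pi_pos
  set a := Real.log s
  set Fa : ℂ := (logSymbol ρ γ lam a)⁻¹ with hFa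
  have hexpa : Complex.exp a = s := by rw [← Complex.ofReal_exp, Real.exp_log hs]
  set q : ℂ → ℂ := fun u => ((logSymbol ρ γ lam u)⁻¹ - (logSymbol ρ γ lam a)⁻¹) *
      (Complex.exp u / (Complex.exp u - Complex.exp a)) with hq
  have hqm : Measurable q := by
    have := (differentiable_logSymbol (ρ := ρ) (γ := γ) (lam := lam)).continuous.measurable
    fun_prop
  set φ : ℝ → ℝ := fun x => Real.exp x * (density ρ γ lam (Real.exp x) / (Real.exp x + s)) with hφ
  have hφ0 : ∀ x, 0 ≤ φ x := fun x => by
    have := density_nonneg hρ hγ hlam (Real.exp_pos x)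
    have := Real.exp_pos x
    positivity
  have hq1 : ∀ x : ℝ, q (x + ((-Real.pi : ℝ) : ℂ) * Complex.I) - q (x + (Real.pi : ℝ) * Complex.I)
      = ((2 * Real.pi * φ x : ℝ) : ℂ) * Complex.I := by
    intro x
    simp only [hq]
    rw [exp_add_pi, exp_sub_pi, ← sub_mul, sub_sub_sub_cancel_right, inv_logSymbol_sub hρ hγ hlam,
      hexpa, hφ]
    have : ((Real.exp x : ℝ) : ℂ) + s ≠ 0 := by
      rw [← Complex.ofReal_add, Complex.ofReal_ne_zero]
      have := Real.exp_pos x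
      positivity
    have e : -((Real.exp x : ℝ) : ℂ) - s = -(Real.exp x + s) := by ring
    rw [e]
    push_cast at this ⊢
    field_simp
  have hcont : ∀ c : ℝ, (c = Real.pi ∨ c = -Real.pi) →
      Continuous fun x : ℝ => q (x + (c : ℂ) * Complex.I) := by
    intro c hc
    have h1 : ∀ x : ℝ, logSymbol ρ γ lam (x + (c : ℂ) * Complex.I) ≠ 0 := fun x =>
      logSymbol_ne_zero hρ hγ hlam (by rcases hc with rfl | rfl <;> simp; linarith)
        (by rcases hc with rfl | rfl <;> simp; linarith)
    have h2 : ∀ x : ℝ, Complex.exp (x + (c : ℂ) * Complex.I) - Complex.exp a ≠ 0 := fun x => by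
      have : Complex.exp (x + (c : ℂ) * Complex.I) = -(Real.exp x : ℂ) := by
        rcases hc with rfl | rfl
        · exact exp_add_pi x
        · exact exp_sub_pi x
      rw [this, hexpa, ← Complex.ofReal_neg, ← Complex.ofReal_sub, Complex.ofReal_ne_zero]
      have := Real.exp_pos x
      intro h
      linarith
    have hP := (differentiable_logSymbol (ρ := ρ) (γ := γ) (lam := lam)).continuous
    have hl : Continuous fun x : ℝ => (x : ℂ) + (c : ℂ) * Complex.I := by fun_prop
    exact (((hP.comp hl).inv₀ h1).sub continuous_const).mul
      ((Complex.continuous_exp.comp hl).div ((Complex.continuous_exp.comp hl).sub continuous_const) h2)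
  have hφc : Continuous φ := by
    have h := (((hcont (-Real.pi) (Or.inr rfl)).sub (hcont Real.pi (Or.inl rfl))).congr hq1)
    have h2 : φ = fun x => (((2 * Real.pi * φ x : ℝ) : ℂ) * Complex.I).im / (2 * Real.pi) := by
      ext x
      simp
    rw [h2]
    exact (Complex.continuous_im.comp h).div_const _
  -- The constant `Fa` cancels between the horizontal edges, leaving the jump. As `R → ∞` the right
  -- edge tends to `-2π Fa` and the left edge to `0`.
  have hrect : ∀ R : ℝ, |a| < R → ((2 * Real.pi * ∫ x in -R..R, φ x : ℝ) : ℂ) =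
      (∫ y : ℝ in -Real.pi..Real.pi, q ((-R : ℝ) + y * Complex.I)) -
      (∫ y : ℝ in -Real.pi..Real.pi, q (R + y * Complex.I)) := by
    intro R hR
    have h := integral_boundary_logSymbol hρ hγ hlam hR q hq
    rw [← intervalIntegral.integral_sub ((hcont _ (Or.inr rfl)).intervalIntegrable _ _)
      ((hcont _ (Or.inl rfl)).intervalIntegrable _ _)] at h
    simp_rw [hq1] at h
    rw [intervalIntegral.integral_mul_const, intervalIntegral.integral_ofReal,
      intervalIntegral.integral_const_mul] at h
    simp only [smul_eq_mul] at h
    have hI := Complex.I_ne_zero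
    apply mul_right_cancel₀ hI
    linear_combination h
  have hlim1 : Tendsto (fun R : ℝ => ∫ y : ℝ in -Real.pi..Real.pi, q (R + y * Complex.I)) atTop
      (𝓝 ((Real.pi - -Real.pi : ℝ) * (-Fa))) := by
    refine tendsto_integral_vertical hqm ?_ _ _
    have h1 := tendsto_exp_mul_comap_re_atTop (c := -1) (by norm_num)
    have h2 : Tendsto (fun u : ℂ => (1 - Complex.exp a * Complex.exp ((-1 : ℝ) * u))⁻¹)
        (comap Complex.re atTop) (𝓝 (1 - Complex.exp a * 0)⁻¹) :=
      (tendsto_const_nhds.sub (h1.const_mul _)).inv₀ (by simp)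
    have h3 := ((tendsto_inv_logSymbol_atTop (γ := γ) (lam := lam) hρ).sub
      (tendsto_const_nhds (x := Fa))).mul h2
    simp only [mul_zero, sub_zero, inv_one, mul_one, zero_sub] at h3
    refine h3.congr fun u => ?_
    have e3 : Complex.exp u ≠ 0 := Complex.exp_ne_zero u
    have e2 : ((-1 : ℝ) : ℂ) * u = -u := by simp
    simp only [hq, hFa]
    rw [e2, Complex.exp_neg]
    congr 1
    rw [← inv_div]
    congr 1
    field_simp
  have hlim2 : Tendsto (fun R : ℝ => ∫ y : ℝ in -Real.pi..Real.pi, q (R + y * Complex.I)) atBot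
      (𝓝 ((Real.pi - -Real.pi : ℝ) * 0)) := by
    refine tendsto_integral_vertical hqm ?_ _ _
    have h1 := tendsto_exp_mul_comap_re_atBot (c := 1) (by norm_num)
    simp only [Complex.ofReal_one, one_mul] at h1
    have h3 := (((tendsto_logSymbol_atBot (γ := γ) (lam := lam) hρ).inv₀ (by simpa using hlam.ne')).sub
      (tendsto_const_nhds (x := Fa))).mul (h1.div (h1.sub (tendsto_const_nhds (x := Complex.exp a)))
        (by simp))
    simpa [hq] using h3
  have hlim : Tendsto (fun R : ℝ => ∫ x in -R..R, φ x) atTop (𝓝 Fa.re) := by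
    have h := (hlim2.comp tendsto_neg_atTop_atBot).sub hlim1
    have h' : Tendsto (fun R : ℝ => ((2 * Real.pi * ∫ x in -R..R, φ x : ℝ) : ℂ)) atTop
        (𝓝 ((Real.pi - -Real.pi : ℝ) * 0 - (Real.pi - -Real.pi : ℝ) * (-Fa))) := by
      refine h.congr' ?_
      filter_upwards [eventually_gt_atTop |a|] with R hR
      rw [hrect R hR]
      rfl
    have h'' := ((Complex.continuous_re.tendsto _).comp h').div_const (2 * Real.pi)
    have e : (((Real.pi - -Real.pi : ℝ) : ℂ) * 0 - ((Real.pi - -Real.pi : ℝ) : ℂ) * (-Fa)).re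
        / (2 * Real.pi) = Fa.re := by
      simp; field_simp; ring
    rw [e] at h''
    refine h''.congr fun R => ?_
    simp only [Function.comp, Complex.ofReal_re]
    field_simp
  -- Since `φ ≥ 0`, convergence of the integrals over `[-R, R]` already gives integrability.
  have hint : Integrable φ := by
    refine integrable_of_intervalIntegral_norm_tendsto Fa.re (l := atTop) (a := fun R : ℝ => -R)
      (b := fun R : ℝ => R) (fun R => (hφc.integrableOn_Icc).mono_set Ioc_subset_Icc_self)
      tendsto_neg_atTop_atBot tendsto_id ?_
    refine hlim.congr fun R => ?_
    congr 1 with x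
    rw [Real.norm_of_nonneg (hφ0 x)]
  have hval : ∫ x, φ x = Fa.re := tendsto_nhds_unique
    (intervalIntegral_tendsto_integral hint tendsto_neg_atTop_atBot tendsto_id) hlim
  refine ⟨(integrableOn_image_exp _).2 hint, ?_⟩
  rw [integral_image_exp, hval, hFa, logSymbol_log hs, ← Complex.ofReal_inv, Complex.ofReal_re]

end Stieltjes

/-! ### Uniqueness of Laplace transforms by polynomial approximation -/

section LaplaceUniqueness

/-- A function on the half line whose Laplace transform vanishes at all positive integers
vanishes almost everywhere. -/
theorem ae_eq_zero_of_laplace_eq_zero {h : ℝ → ℝ}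
    (hint : IntegrableOn (fun t => Real.exp (-t) * h t) (Ioi 0))
    (hzero : ∀ n : ℕ, ∫ t in Ioi (0 : ℝ), Real.exp (-t) ^ n * (Real.exp (-t) * h t) = 0) :
    ∀ᵐ t : ℝ, t ∈ Ioi 0 → h t = 0 := by
  set φ : ℝ → ℝ := fun t => Real.exp (-t) * h t with hφ
  have hexp : ∀ t ∈ Ioi (0 : ℝ), Real.exp (-t) ∈ Icc (0 : ℝ) 1 := fun t ht =>
    ⟨(Real.exp_pos _).le, Real.exp_le_one_iff.2 (by simpa using (le_of_lt ht))⟩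
  have hmul : ∀ F : ℝ → ℝ, Measurable F → ∀ c, (∀ x ∈ Icc (0 : ℝ) 1, |F x| ≤ c) →
      IntegrableOn (fun t => F (Real.exp (-t)) * φ t) (Ioi 0) := by
    intro F hF c hc
    refine Integrable.bdd_mul (c := c) hint (hF.comp (by fun_prop)).aestronglyMeasurable ?_
    filter_upwards [ae_restrict_mem measurableSet_Ioi] with t ht
    exact hc _ (hexp t ht)
  -- In the variable `x = e^(-t)` the hypotheses say that all moments vanish; Weierstrass
  -- approximation extends this to continuous functions on `[0, 1]`.
  have hpoly : ∀ p : Polynomial ℝ, ∫ t in Ioi (0 : ℝ), p.eval (Real.exp (-t)) * φ t = 0 := by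
    intro p
    induction p using Polynomial.induction_on' with
    | add p q hp hq =>
      obtain ⟨c, hc⟩ := (isCompact_Icc (a := (0 : ℝ)) (b := 1)).exists_bound_of_continuousOn
        p.continuous.continuousOn
      obtain ⟨d, hd⟩ := (isCompact_Icc (a := (0 : ℝ)) (b := 1)).exists_bound_of_continuousOn
        q.continuous.continuousOn
      simp only [Polynomial.eval_add, add_mul]
      rw [integral_add (hmul _ p.continuous.measurable c hc) (hmul _ q.continuous.measurable d hd),
        hp, hq, add_zero]
    | monomial n a =>
      simp only [Polynomial.eval_monomial, mul_assoc]
      rw [integral_const_mul, hzero n, mul_zero]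
  have hcont : ∀ F : ℝ → ℝ, Measurable F → ContinuousOn F (Icc 0 1) →
      ∫ t in Ioi (0 : ℝ), F (Real.exp (-t)) * φ t = 0 := by
    intro F hFm hF
    have hI : 0 ≤ ∫ t in Ioi (0 : ℝ), |φ t| := integral_nonneg fun t => abs_nonneg _
    by_contra hne
    set J := ∫ t in Ioi (0 : ℝ), F (Real.exp (-t)) * φ t
    set I := ∫ t in Ioi (0 : ℝ), |φ t|
    have hJ : 0 < |J| := abs_pos.2 hne
    -- With this tolerance the error is at most `|J| I / (I + 1) < |J|`, a contradiction.
    obtain ⟨p, hp⟩ := exists_polynomial_near_of_continuousOn 0 1 F hF (|J| / (I + 1)) (by positivity)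
    obtain ⟨c, hc⟩ := (isCompact_Icc (a := (0 : ℝ)) (b := 1)).exists_bound_of_continuousOn
        p.continuous.continuousOn
    obtain ⟨d, hd⟩ := (isCompact_Icc (a := (0 : ℝ)) (b := 1)).exists_bound_of_continuousOn hF
    have e : J = -∫ t in Ioi (0 : ℝ), (p.eval (Real.exp (-t)) * φ t - F (Real.exp (-t)) * φ t) := by
      rw [integral_sub (hmul _ p.continuous.measurable c hc) (hmul _ hFm d hd), hpoly]
      simp [J]
    have h2 : |J| ≤ ∫ t in Ioi (0 : ℝ), |J| / (I + 1) * |φ t| := by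
      nth_rewrite 1 [e]
      rw [abs_neg, ← Real.norm_eq_abs]
      refine norm_integral_le_of_norm_le (hint.abs.const_mul _) ?_
      filter_upwards [ae_restrict_mem measurableSet_Ioi] with t ht
      rw [← sub_mul, norm_mul, Real.norm_eq_abs, Real.norm_eq_abs]
      exact mul_le_mul_of_nonneg_right (hp _ (hexp t ht)).le (abs_nonneg _)
    rw [integral_const_mul] at h2
    have h3 : |J| / (I + 1) * I < |J| := by
      rw [div_mul_eq_mul_div, div_lt_iff₀ (by positivity)]
      nlinarith
    exact absurd h2 (not_le.2 h3)
  have hφ0 : ∀ᵐ t : ℝ, t ∈ Ioi 0 → φ t = 0 := by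
    refine isOpen_Ioi.ae_eq_zero_of_integral_contDiff_smul_eq_zero hint.locallyIntegrableOn ?_
    intro g hg hgc hgU
    have hg0 : ∀ t, t ∉ Ioi (0 : ℝ) → g t = 0 := fun t ht =>
      image_eq_zero_of_notMem_tsupport fun h => ht (hgU h)
    have e1 : ∫ t, g t • φ t = ∫ t in Ioi (0 : ℝ), g (-Real.log (Real.exp (-t))) * φ t := by
      rw [← setIntegral_eq_integral_of_forall_compl_eq_zero (s := Ioi (0 : ℝ))
        (fun t ht => by rw [hg0 t ht, zero_smul])]
      simp
    rw [e1]
    -- Continuity at `x = 0` holds because `g` vanishes for large argument; the value at `0` itself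
    -- is `g 0 = 0`, as `Real.log 0 = 0`.
    refine hcont (fun x => g (-Real.log x)) (hg.continuous.measurable.comp (by fun_prop)) ?_
    intro x hx
    rcases eq_or_lt_of_le hx.1 with h0 | h0
    · obtain ⟨R, hR⟩ := hgc.isCompact.bddAbove
      have hz : ∀ᶠ y in 𝓝[Icc 0 1] x, g (-Real.log y) = 0 := by
        have : Icc (0 : ℝ) 1 ∩ Iio (Real.exp (-(|R| + 1))) ∈ 𝓝[Icc 0 1] x :=
          inter_mem_nhdsWithin _ (Iio_mem_nhds (by rw [← h0]; exact Real.exp_pos _))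
        filter_upwards [this] with y hy
        rcases eq_or_lt_of_le hy.1.1 with h1 | h1
        · rw [← h1]; simp [hg0]
        · apply image_eq_zero_of_notMem_tsupport
          intro hm
          have h3 := hR hm
          have h4 := (Real.log_lt_iff_lt_exp h1).2 hy.2
          have := le_abs_self R
          linarith
      have hx0 : g (-Real.log x) = 0 := by rw [← h0]; simp [hg0]
      refine Tendsto.congr' (f₁ := fun _ => 0) (hz.mono fun y hy => hy.symm) ?_
      simp only [hx0]
      exact tendsto_const_nhds
    · exact (hg.continuous.continuousAt.comp (Real.continuousAt_log h0.ne').neg).continuousWithinAt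
  filter_upwards [hφ0] with t ht h
  have := ht h
  exact (mul_eq_zero.1 this).resolve_left (Real.exp_pos _).ne'

end LaplaceUniqueness

/-! ### Exchange of integrals for nonnegative integrands -/

section Fubini

/-- By nonnegativity, integrability of the computed inner integral `F` is all that Fubini requires.
The kernels are positive mixtures of exponentials, so their transforms and primitives are all
obtained this way. -/
lemma integrable_and_integral_swap_of_nonneg {μ ν : Measure ℝ} [SFinite μ] [SFinite ν]
    {f : ℝ → ℝ → ℝ} (hf : Measurable (Function.uncurry f))
    (h0 : ∀ᵐ y ∂ν, ∀ᵐ x ∂μ, 0 ≤ f x y) {F : ℝ → ℝ}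
    (h1 : ∀ᵐ y ∂ν, Integrable (fun x => f x y) μ ∧ ∫ x, f x y ∂μ = F y) (h2 : Integrable F ν) :
    Integrable (fun x => ∫ y, f x y ∂ν) μ ∧ ∫ x, ∫ y, f x y ∂ν ∂μ = ∫ y, F y ∂ν := by
  have hi : Integrable (Function.uncurry f) (μ.prod ν) := by
    rw [integrable_prod_iff' hf.aestronglyMeasurable]
    refine ⟨h1.mono fun y hy => hy.1, h2.congr ?_⟩
    filter_upwards [h0, h1] with y hy0 hy1
    rw [← hy1.2]
    refine integral_congr_ae ?_
    filter_upwards [hy0] with x hx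
    exact (Real.norm_of_nonneg hx).symm
  refine ⟨hi.integral_prod_left, ?_⟩
  rw [integral_integral_swap hi]
  exact integral_congr_ae (h1.mono fun y hy => hy.2)

end Fubini

/-! ### Bounds, Laplace transforms and the Volterra equation of the kernels -/

section Kernels

variable {ρ γ lam : ℝ}

/-- The symbol `s + λγ s^ρ + λ`, whose reciprocal is the Laplace transform of `kernelB`. -/
noncomputable def symbol (ρ γ lam s : ℝ) : ℝ := s + lam * γ * s ^ ρ + lam

lemma symbol_pos (hγ : 0 < γ) (hlam : 0 < lam) {s : ℝ} (hs : 0 < s) : 0 < symbol ρ γ lam s := by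
  unfold symbol; positivity

lemma tendsto_div_symbol (hρ : ρ ∈ Ioo (0 : ℝ) 1) :
    Tendsto (fun s => s / symbol ρ γ lam s) atTop (𝓝 1) := by
  have h1 : Tendsto (fun s : ℝ => s ^ (-(1 - ρ))) atTop (𝓝 0) :=
    tendsto_rpow_neg_atTop (by linarith [hρ.2])
  have h2 : Tendsto (fun s : ℝ => s⁻¹) atTop (𝓝 0) := tendsto_inv_atTop_zero
  have h3 : Tendsto (fun s : ℝ => (1 + lam * γ * s ^ (-(1 - ρ)) + lam * s⁻¹)⁻¹) atTop
      (𝓝 (1 + lam * γ * 0 + lam * 0)⁻¹) :=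
    ((tendsto_const_nhds.add (h1.const_mul _)).add (h2.const_mul _)).inv₀ (by simp)
  simp only [mul_zero, add_zero, inv_one] at h3
  refine h3.congr' ?_
  filter_upwards [eventually_gt_atTop 0] with s hs
  rw [symbol, ← inv_div, neg_sub, Real.rpow_sub_one hs.ne']
  congr 1
  field_simp

/-- The spectral density is a probability density on the half line. -/
lemma integrableOn_density (hρ : ρ ∈ Ioo (0 : ℝ) 1) (hγ : 0 < γ) (hlam : 0 < lam) :
    IntegrableOn (density ρ γ lam) (Ioi 0) ∧ ∫ r in Ioi (0 : ℝ), density ρ γ lam r = 1 := by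
  have hs : ∀ n : ℕ, (0 : ℝ) < n + 1 := fun n => by positivity
  have hnn : ∀ᵐ r ∂(volume.restrict (Ioi (0 : ℝ))), 0 ≤ density ρ γ lam r := by
    filter_upwards [ae_restrict_mem measurableSet_Ioi] with r hr
    exact density_nonneg hρ hγ hlam hr
  have hlin : ∫⁻ r in Ioi (0 : ℝ), ENNReal.ofReal (density ρ γ lam r) = 1 := by
    -- Monotone convergence of `s μ(r)/(r+s) ↑ μ(r)` along `s = n + 1`, whose integrals `s / symbol
    -- s` tend to `1`.
    refine tendsto_nhds_unique (lintegral_tendsto_of_tendsto_of_monotone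
      (μ := volume.restrict (Ioi (0 : ℝ)))
      (f := fun (n : ℕ) r => ENNReal.ofReal ((n + 1) * (density ρ γ lam r / (r + (n + 1)))))
      (F := fun r => ENNReal.ofReal (density ρ γ lam r)) (fun n => ?_) ?_ ?_) ?_
    · fun_prop
    · filter_upwards [ae_restrict_mem measurableSet_Ioi] with r hr
      have hr' : (0 : ℝ) < r := hr
      have hd := density_nonneg hρ hγ hlam hr
      intro m n hmn
      have hmn' : (m : ℝ) ≤ n := by exact_mod_cast hmn
      have := hs m
      have := hs n
      apply ENNReal.ofReal_le_ofReal
      rw [← mul_div_assoc, ← mul_div_assoc, div_le_div_iff₀ (by positivity) (by positivity)]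
      have : 0 ≤ density ρ γ lam r * r * (n - m) :=
        mul_nonneg (mul_nonneg hd hr'.le) (by linarith)
      nlinarith
    · filter_upwards [ae_restrict_mem measurableSet_Ioi] with r hr
      have hr' : (0 : ℝ) < r := hr
      refine (ENNReal.continuous_ofReal.tendsto _).comp ?_
      have h1 : Tendsto (fun n : ℕ => ((n : ℝ) + 1)) atTop atTop :=
        tendsto_atTop_add_const_right _ _ tendsto_natCast_atTop_atTop
      have h2 : Tendsto (fun n : ℕ => density ρ γ lam r * (r * ((n : ℝ) + 1)⁻¹ + 1)⁻¹) atTop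
          (𝓝 (density ρ γ lam r * (r * 0 + 1)⁻¹)) :=
        ((((tendsto_inv_atTop_zero.comp h1).const_mul r).add_const 1).inv₀ (by simp)).const_mul _
      simp only [mul_zero, zero_add, inv_one, mul_one] at h2
      refine h2.congr fun n => ?_
      have := hs n
      field_simp
    · have h1 : Tendsto (fun n : ℕ => ((n : ℝ) + 1)) atTop atTop :=
        tendsto_atTop_add_const_right _ _ tendsto_natCast_atTop_atTop
      have h2 := (ENNReal.continuous_ofReal.tendsto _).comp
        ((tendsto_div_symbol (γ := γ) (lam := lam) hρ).comp h1)
      rw [ENNReal.ofReal_one] at h2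
      refine h2.congr fun n => ?_
      obtain ⟨h3, h4⟩ := stieltjes_density hρ hγ hlam (hs n)
      rw [← ofReal_integral_eq_lintegral_ofReal (h3.const_mul _), integral_const_mul, h4]
      · rfl
      · filter_upwards [ae_restrict_mem measurableSet_Ioi] with r hr
        have hr' : (0 : ℝ) < r := hr
        have := density_nonneg hρ hγ hlam hr
        have := hs n
        positivity
  have hi : IntegrableOn (density ρ γ lam) (Ioi 0) := by
    refine ⟨measurable_density.aestronglyMeasurable, ?_⟩
    rw [hasFiniteIntegral_iff_ofReal hnn, hlin]
    exact ENNReal.one_lt_top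
  refine ⟨hi, ?_⟩
  rw [integral_eq_lintegral_of_nonneg_ae hnn measurable_density.aestronglyMeasurable, hlin]
  simp

/-- Minus the time derivative of `kernelB`. -/
noncomputable def kernelD (ρ γ lam t : ℝ) : ℝ :=
  ∫ r in Ioi (0 : ℝ), Real.exp (-r * t) * (r * density ρ γ lam r)

@[fun_prop]
lemma measurable_kernelB : Measurable (kernelB ρ γ lam) := by
  have : kernelB ρ γ lam = fun t => ∫ r in Ioi (0 : ℝ), Real.exp (-r * t) * density ρ γ lam r :=
    funext fun t => kernelB_eq_integral_density ρ γ lam t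
  rw [this]
  refine (StronglyMeasurable.integral_prod_right (Measurable.stronglyMeasurable ?_)).measurable
  unfold Function.uncurry
  fun_prop

@[fun_prop]
lemma measurable_kernelD : Measurable (kernelD ρ γ lam) := by
  unfold kernelD
  refine (StronglyMeasurable.integral_prod_right (Measurable.stronglyMeasurable ?_)).measurable
  unfold Function.uncurry
  fun_prop

/-- With `x = rt` the right side is `t⁻¹/(r + t⁻¹)`, a Stieltjes kernel at `s = 1/t`: pointwise
bounds on the kernels at `t` reduce to the exact value of the symbol at `1/t`. -/
lemma exp_neg_le_inv_one_add {x : ℝ} (hx : 0 ≤ x) : Real.exp (-x) ≤ (1 + x)⁻¹ := by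
  rw [Real.exp_neg]
  exact inv_anti₀ (by positivity) (by linarith [Real.add_one_le_exp x])

lemma kernelB_nonneg (hρ : ρ ∈ Ioo (0 : ℝ) 1) (hγ : 0 < γ) (hlam : 0 < lam) (t : ℝ) :
    0 ≤ kernelB ρ γ lam t := by
  rw [kernelB_eq_integral_density]
  refine setIntegral_nonneg measurableSet_Ioi fun r hr => ?_
  exact mul_nonneg (Real.exp_pos _).le (density_nonneg hρ hγ hlam hr)

lemma kernelD_nonneg (hρ : ρ ∈ Ioo (0 : ℝ) 1) (hγ : 0 < γ) (hlam : 0 < lam) (t : ℝ) :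
    0 ≤ kernelD ρ γ lam t := by
  refine setIntegral_nonneg measurableSet_Ioi fun r hr => ?_
  exact mul_nonneg (Real.exp_pos _).le (mul_nonneg (le_of_lt hr) (density_nonneg hρ hγ hlam hr))

lemma integrableOn_exp_mul_density (hρ : ρ ∈ Ioo (0 : ℝ) 1) (hγ : 0 < γ) (hlam : 0 < lam) {t : ℝ}
    (ht : 0 ≤ t) : IntegrableOn (fun r => Real.exp (-r * t) * density ρ γ lam r) (Ioi 0) := by
  refine Integrable.bdd_mul (c := 1) (integrableOn_density hρ hγ hlam).1
    (by fun_prop) ?_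
  filter_upwards [ae_restrict_mem measurableSet_Ioi] with r hr
  rw [Real.norm_of_nonneg (Real.exp_pos _).le]
  refine Real.exp_le_one_iff.2 ?_
  have : (0 : ℝ) < r := hr
  nlinarith

lemma kernelB_le_one (hρ : ρ ∈ Ioo (0 : ℝ) 1) (hγ : 0 < γ) (hlam : 0 < lam) {t : ℝ}
    (ht : 0 ≤ t) : kernelB ρ γ lam t ≤ 1 := by
  rw [kernelB_eq_integral_density, ← (integrableOn_density hρ hγ hlam).2]
  refine setIntegral_mono_on (integrableOn_exp_mul_density hρ hγ hlam ht)
    (integrableOn_density hρ hγ hlam).1 measurableSet_Ioi fun r hr => ?_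
  refine mul_le_of_le_one_left (density_nonneg hρ hγ hlam hr) (Real.exp_le_one_iff.2 ?_)
  have : (0 : ℝ) < r := hr
  nlinarith

lemma kernelB_le_symbol (hρ : ρ ∈ Ioo (0 : ℝ) 1) (hγ : 0 < γ) (hlam : 0 < lam) {t : ℝ}
    (ht : 0 < t) : kernelB ρ γ lam t ≤ t⁻¹ * (symbol ρ γ lam t⁻¹)⁻¹ := by
  obtain ⟨h1, h2⟩ := stieltjes_density hρ hγ hlam (inv_pos.2 ht)
  rw [kernelB_eq_integral_density, symbol, ← h2, ← integral_const_mul]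
  refine setIntegral_mono_on (integrableOn_exp_mul_density hρ hγ hlam ht.le)
    (h1.const_mul _) measurableSet_Ioi fun r hr => ?_
  have hr' : (0 : ℝ) < r := hr
  have := density_nonneg hρ hγ hlam hr
  have h3 := exp_neg_le_inv_one_add (mul_nonneg hr'.le ht.le)
  calc Real.exp (-r * t) * density ρ γ lam r ≤ (1 + r * t)⁻¹ * density ρ γ lam r := by
        rw [neg_mul]; exact mul_le_mul_of_nonneg_right h3 this
    _ = t⁻¹ * (density ρ γ lam r / (r + t⁻¹)) := by
        field_simp
        ring

/-- Only the term `λγ s^ρ` of the symbol is kept. The bound is integrable and free of `λ`, which is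
why `AV` is controlled by `f` without fractional smoothness. -/
lemma kernelB_le_rpow (hρ : ρ ∈ Ioo (0 : ℝ) 1) (hγ : 0 < γ) (hlam : 0 < lam) {t : ℝ}
    (ht : 0 < t) : lam * kernelB ρ γ lam t ≤ γ⁻¹ * t ^ (ρ - 1) := by
  have h1 := kernelB_le_symbol hρ hγ hlam ht
  have h2 : t⁻¹ * (symbol ρ γ lam t⁻¹)⁻¹ ≤ t⁻¹ * (lam * γ * (t⁻¹) ^ ρ)⁻¹ := by
    refine mul_le_mul_of_nonneg_left (inv_anti₀ (by positivity) ?_) (by positivity)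
    have : 0 < t⁻¹ := by positivity
    unfold symbol
    linarith
  calc lam * kernelB ρ γ lam t ≤ lam * (t⁻¹ * (lam * γ * (t⁻¹) ^ ρ)⁻¹) :=
        mul_le_mul_of_nonneg_left (h1.trans h2) hlam.le
    _ = γ⁻¹ * t ^ (ρ - 1) := by
        rw [Real.inv_rpow ht.le, Real.rpow_sub_one ht.ne']
        have : 0 < t ^ ρ := by positivity
        field_simp

lemma exp_mul_density_le (hρ : ρ ∈ Ioo (0 : ℝ) 1) (hγ : 0 < γ) (hlam : 0 < lam) {t : ℝ}
    (ht : 0 < t) {r : ℝ} (hr : 0 < r) : Real.exp (-r * t) * (r * density ρ γ lam r) ≤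
      t⁻¹ * (density ρ γ lam r - t⁻¹ * (density ρ γ lam r / (r + t⁻¹))) := by
  have := density_nonneg hρ hγ hlam hr
  have h3 := exp_neg_le_inv_one_add (mul_nonneg hr.le ht.le)
  calc Real.exp (-r * t) * (r * density ρ γ lam r) ≤ (1 + r * t)⁻¹ * (r * density ρ γ lam r) := by
        rw [neg_mul]; exact mul_le_mul_of_nonneg_right h3 (by positivity)
    _ = t⁻¹ * (density ρ γ lam r - t⁻¹ * (density ρ γ lam r / (r + t⁻¹))) := by
        field_simp
        ring

lemma kernelD_le_symbol (hρ : ρ ∈ Ioo (0 : ℝ) 1) (hγ : 0 < γ) (hlam : 0 < lam) {t : ℝ}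
    (ht : 0 < t) : kernelD ρ γ lam t ≤ t⁻¹ * (1 - t⁻¹ * (symbol ρ γ lam t⁻¹)⁻¹) := by
  obtain ⟨h1, h2⟩ := stieltjes_density hρ hγ hlam (inv_pos.2 ht)
  obtain ⟨h3, h4⟩ := integrableOn_density hρ hγ hlam
  have hi := (h3.sub (h1.const_mul t⁻¹)).const_mul t⁻¹
  rw [kernelD, symbol, ← h2, ← h4, ← integral_const_mul, ← integral_sub h3 (h1.const_mul _),
    ← integral_const_mul]
  refine integral_mono_of_nonneg ?_ hi ?_
  · filter_upwards [ae_restrict_mem measurableSet_Ioi] with r hr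
    exact mul_nonneg (Real.exp_pos _).le (mul_nonneg (le_of_lt hr) (density_nonneg hρ hγ hlam hr))
  · filter_upwards [ae_restrict_mem measurableSet_Ioi] with r hr
    exact exp_mul_density_le hρ hγ hlam ht hr

/-- The smoothing estimate: a factor `λ^ε` compensates the singularity of `∂ₜ B`. -/
lemma kernelD_le_rpow (hρ : ρ ∈ Ioo (0 : ℝ) 1) (hγ : 0 < γ) (hlam : 0 < lam) {ε : ℝ}
    (hε : ε ∈ Ioo (0 : ℝ) 1) {t T : ℝ} (ht : 0 < t) (htT : t ≤ T) :
    lam ^ (-ε) * kernelD ρ γ lam t ≤ (T ^ ρ + γ) ^ ε * t ^ (ε * (1 - ρ) - 1) := by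
  have h1 := kernelD_le_symbol hρ hγ hlam ht
  -- Chosen so that `t * symbol t⁻¹ = 1 + x`; then `x/(1+x) ≤ min x 1 ≤ x^ε` trades the singularity
  -- for a power of `λ`.
  set x := lam * (γ * t ^ (1 - ρ) + t) with hx
  have hx0 : 0 < x := by positivity
  have h2 : t⁻¹ * (1 - t⁻¹ * (symbol ρ γ lam t⁻¹)⁻¹) = t⁻¹ * (x / (1 + x)) := by
    have h3 := symbol_pos (ρ := ρ) hγ hlam (inv_pos.2 ht)
    have h4 : t * symbol ρ γ lam t⁻¹ = 1 + x := by
      rw [symbol, hx, Real.inv_rpow ht.le, Real.rpow_sub ht, Real.rpow_one]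
      have : 0 < t ^ ρ := by positivity
      field_simp
      ring
    rw [← mul_inv, h4]
    congr 1
    field_simp
    ring
  have h3 : x / (1 + x) ≤ x ^ ε := by
    rcases le_total x 1 with h | h
    · calc x / (1 + x) ≤ x := div_le_self hx0.le (by linarith)
        _ = x ^ (1 : ℝ) := (Real.rpow_one x).symm
        _ ≤ x ^ ε := Real.rpow_le_rpow_of_exponent_ge hx0 h hε.2.le
    · calc x / (1 + x) ≤ 1 := (div_le_one (by positivity)).2 (by linarith)
        _ ≤ x ^ ε := Real.one_le_rpow h hε.1.le
  have hT : 0 < T := ht.trans_le htT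
  have h4 : x ≤ lam * ((T ^ ρ + γ) * t ^ (1 - ρ)) := by
    rw [hx]
    refine mul_le_mul_of_nonneg_left ?_ hlam.le
    have : t ≤ T ^ ρ * t ^ (1 - ρ) := by
      calc t = t ^ ρ * t ^ (1 - ρ) := by rw [← Real.rpow_add ht]; simp
        _ ≤ T ^ ρ * t ^ (1 - ρ) := by
          refine mul_le_mul_of_nonneg_right (Real.rpow_le_rpow ht.le htT hρ.1.le) (by positivity)
    linarith
  have h5 : x ^ ε ≤ lam ^ ε * ((T ^ ρ + γ) ^ ε * t ^ (ε * (1 - ρ))) := by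
    refine (Real.rpow_le_rpow hx0.le h4 hε.1.le).trans_eq ?_
    rw [Real.mul_rpow hlam.le (by positivity), Real.mul_rpow (by positivity) (by positivity),
      ← Real.rpow_mul ht.le, mul_comm (1 - ρ)]
  have h6 : kernelD ρ γ lam t ≤ t⁻¹ * (lam ^ ε * ((T ^ ρ + γ) ^ ε * t ^ (ε * (1 - ρ)))) := by
    refine h1.trans ?_
    rw [h2]
    exact mul_le_mul_of_nonneg_left (h3.trans h5) (by positivity)
  calc lam ^ (-ε) * kernelD ρ γ lam t
      ≤ lam ^ (-ε) * (t⁻¹ * (lam ^ ε * ((T ^ ρ + γ) ^ ε * t ^ (ε * (1 - ρ))))) :=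
        mul_le_mul_of_nonneg_left h6 (by positivity)
    _ = (T ^ ρ + γ) ^ ε * t ^ (ε * (1 - ρ) - 1) := by
        rw [Real.rpow_neg hlam.le, Real.rpow_sub_one ht.ne']
        have : 0 < lam ^ ε := by positivity
        field_simp

lemma integrableOn_exp_neg_mul {a : ℝ} (ha : 0 < a) :
    IntegrableOn (fun t => Real.exp (-a * t)) (Ioi 0) ∧
      ∫ t in Ioi (0 : ℝ), Real.exp (-a * t) = a⁻¹ := by
  refine ⟨integrableOn_exp_mul_Ioi (by linarith) 0, ?_⟩
  rw [integral_exp_mul_Ioi (by linarith)]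
  simp

lemma laplace_kernelB (hρ : ρ ∈ Ioo (0 : ℝ) 1) (hγ : 0 < γ) (hlam : 0 < lam) {s : ℝ}
    (hs : 0 < s) : IntegrableOn (fun t => Real.exp (-s * t) * kernelB ρ γ lam t) (Ioi 0) ∧
      ∫ t in Ioi (0 : ℝ), Real.exp (-s * t) * kernelB ρ γ lam t = (symbol ρ γ lam s)⁻¹ := by
  obtain ⟨h1, h2⟩ := stieltjes_density hρ hγ hlam hs
  have := integrable_and_integral_swap_of_nonneg (μ := volume.restrict (Ioi 0))
    (ν := volume.restrict (Ioi 0))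
    (f := fun t r => Real.exp (-s * t) * (Real.exp (-r * t) * density ρ γ lam r))
    (by unfold Function.uncurry; fun_prop) (F := fun r => density ρ γ lam r / (r + s))
    ?_ ?_ h1
  · rw [h2] at this
    simp only [integral_const_mul, ← kernelB_eq_integral_density] at this
    exact this
  · filter_upwards [ae_restrict_mem measurableSet_Ioi] with r hr
    have := density_nonneg hρ hγ hlam hr
    exact Eventually.of_forall fun t => by positivity
  · filter_upwards [ae_restrict_mem measurableSet_Ioi] with r hr
    have hr' : (0 : ℝ) < r := hr
    have e : (fun t => Real.exp (-s * t) * (Real.exp (-r * t) * density ρ γ lam r)) =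
        fun t => Real.exp (-(r + s) * t) * density ρ γ lam r := by
      ext t
      rw [← mul_assoc, ← Real.exp_add]; ring_nf
    obtain ⟨h3, h4⟩ := integrableOn_exp_neg_mul (a := r + s) (by positivity)
    rw [e]
    refine ⟨h3.mul_const _, ?_⟩
    rw [integral_mul_const, h4]
    field_simp

lemma laplace_kernelD (hρ : ρ ∈ Ioo (0 : ℝ) 1) (hγ : 0 < γ) (hlam : 0 < lam) {s : ℝ}
    (hs : 0 < s) : IntegrableOn (fun t => Real.exp (-s * t) * kernelD ρ γ lam t) (Ioi 0) ∧
      ∫ t in Ioi (0 : ℝ), Real.exp (-s * t) * kernelD ρ γ lam t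
        = 1 - s * (symbol ρ γ lam s)⁻¹ := by
  obtain ⟨h1, h2⟩ := stieltjes_density hρ hγ hlam hs
  obtain ⟨h1', h2'⟩ := integrableOn_density hρ hγ hlam
  have := integrable_and_integral_swap_of_nonneg (μ := volume.restrict (Ioi 0))
    (ν := volume.restrict (Ioi 0))
    (f := fun t r => Real.exp (-s * t) * (Real.exp (-r * t) * (r * density ρ γ lam r)))
    (by unfold Function.uncurry; fun_prop)
    (F := fun r => density ρ γ lam r - s * (density ρ γ lam r / (r + s)))
    ?_ ?_ (h1'.sub (h1.const_mul s))
  · rw [integral_sub h1' (h1.const_mul s), integral_const_mul, h2, h2'] at this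
    simp only [integral_const_mul] at this
    exact this
  · filter_upwards [ae_restrict_mem measurableSet_Ioi] with r hr
    have := density_nonneg hρ hγ hlam hr
    have hr' : (0 : ℝ) < r := hr
    exact Eventually.of_forall fun t => by positivity
  · filter_upwards [ae_restrict_mem measurableSet_Ioi] with r hr
    have hr' : (0 : ℝ) < r := hr
    have e : (fun t => Real.exp (-s * t) * (Real.exp (-r * t) * (r * density ρ γ lam r))) =
        fun t => Real.exp (-(r + s) * t) * (r * density ρ γ lam r) := by
      ext t
      rw [← mul_assoc, ← Real.exp_add]; ring_nf
    obtain ⟨h3, h4⟩ := integrableOn_exp_neg_mul (a := r + s) (by positivity)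
    rw [e]
    refine ⟨h3.mul_const _, ?_⟩
    rw [integral_mul_const, h4]
    field_simp
    ring

/-- This is `D = -B'` in integrated form, with `B(0) = 1`. It also shows that `D` is integrable at
`0`. -/
lemma integral_kernelD (hρ : ρ ∈ Ioo (0 : ℝ) 1) (hγ : 0 < γ) (hlam : 0 < lam) {t : ℝ}
    (ht : 0 ≤ t) : IntegrableOn (kernelD ρ γ lam) (Ioc 0 t) ∧
      ∫ x in (0 : ℝ)..t, kernelD ρ γ lam x = 1 - kernelB ρ γ lam t := by
  obtain ⟨h1, h2⟩ := integrableOn_density hρ hγ hlam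
  have h3 := integrableOn_exp_mul_density hρ hγ hlam ht
  have := integrable_and_integral_swap_of_nonneg (μ := volume.restrict (Ioc 0 t))
    (ν := volume.restrict (Ioi 0))
    (f := fun x r => (Real.exp (-r * x) * (r * density ρ γ lam r)))
    (by unfold Function.uncurry; fun_prop)
    (F := fun r => density ρ γ lam r - Real.exp (-r * t) * density ρ γ lam r)
    ?_ ?_ (h1.sub h3)
  · rw [integral_sub h1 h3, h2, ← kernelB_eq_integral_density,
      ← intervalIntegral.integral_of_le ht] at this
    exact this
  · filter_upwards [ae_restrict_mem measurableSet_Ioi] with r hr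
    have := density_nonneg hρ hγ hlam hr
    have hr' : (0 : ℝ) < r := hr
    exact Eventually.of_forall fun t => by positivity
  · filter_upwards [ae_restrict_mem measurableSet_Ioi] with r hr
    have hr' : (0 : ℝ) < r := hr
    refine ⟨(Continuous.integrableOn_Icc (by fun_prop)).mono_set Ioc_subset_Icc_self, ?_⟩
    rw [← intervalIntegral.integral_of_le ht]
    have hd : ∀ x ∈ uIcc 0 t, HasDerivAt (fun x => -(Real.exp (-r * x) * density ρ γ lam r))
        (Real.exp (-r * x) * (r * density ρ γ lam r)) x := by
      intro x _
      have h := (((((hasDerivAt_id x).const_mul (-r)).exp).mul_const (density ρ γ lam r)).neg)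
      refine h.congr_deriv ?_
      simp
      ring
    rw [intervalIntegral.integral_eq_sub_of_hasDerivAt hd
      (Continuous.intervalIntegrable (by fun_prop) _ _)]
    simp
    ring

/-- The convolution kernel of the Caputo derivative. -/
noncomputable def caputoKernel (ρ t : ℝ) : ℝ := (Real.Gamma (1 - ρ))⁻¹ * t ^ (-ρ)

@[fun_prop]
lemma measurable_caputoKernel : Measurable (caputoKernel ρ) := by
  unfold caputoKernel; fun_prop

lemma caputoKernel_nonneg (hρ : ρ ∈ Ioo (0 : ℝ) 1) {t : ℝ} (ht : 0 ≤ t) :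
    0 ≤ caputoKernel ρ t := by
  have := Real.Gamma_pos_of_pos (sub_pos.2 hρ.2)
  unfold caputoKernel
  positivity

lemma laplace_caputoKernel (hρ : ρ ∈ Ioo (0 : ℝ) 1) {s : ℝ} (hs : 0 < s) :
    IntegrableOn (fun t => Real.exp (-s * t) * caputoKernel ρ t) (Ioi 0) ∧
      ∫ t in Ioi (0 : ℝ), Real.exp (-s * t) * caputoKernel ρ t = s ^ ρ / s := by
  have hG := Real.Gamma_pos_of_pos (sub_pos.2 hρ.2)
  have h1 := integrableOn_rpow_mul_exp_neg_mul_rpow (p := 1) (s := -ρ) (b := s)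
    (by linarith [hρ.2]) one_pos hs
  have h2 := Real.integral_rpow_mul_exp_neg_mul_Ioi (a := 1 - ρ) (sub_pos.2 hρ.2) hs
  have e : (fun t => Real.exp (-s * t) * caputoKernel ρ t) = fun t =>
      (Real.Gamma (1 - ρ))⁻¹ * (t ^ (1 - ρ - 1) * Real.exp (-(s * t))) := by
    ext t
    rw [caputoKernel, show (1 : ℝ) - ρ - 1 = -ρ by ring, neg_mul]; ring
  refine ⟨?_, ?_⟩
  · rw [e]
    refine Integrable.const_mul ?_ _
    refine h1.congr_fun (fun t _ => ?_) measurableSet_Ioi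
    simp only [Real.rpow_one]
    rw [show (1 : ℝ) - ρ - 1 = -ρ by ring, neg_mul]
  · rw [e, integral_const_mul, h2, Real.rpow_sub (by positivity), Real.rpow_one, one_div,
      Real.inv_rpow hs.le]
    have : 0 < s ^ ρ := by positivity
    field_simp

/-- The factor `e^(-st) = e^(-sτ) e^(-s(t-τ))` distributes over the convolution, so the weighted
convolution is one of integrable functions. -/
lemma laplace_conv {a b : ℝ → ℝ} {s : ℝ}
    (ha : IntegrableOn (fun t => Real.exp (-s * t) * a t) (Ioi 0))
    (hb : IntegrableOn (fun t => Real.exp (-s * t) * b t) (Ioi 0)) :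
    IntegrableOn (fun t => Real.exp (-s * t) * ∫ τ in (0 : ℝ)..t, a (t - τ) * b τ) (Ioi 0) ∧
      ∫ t in Ioi (0 : ℝ), Real.exp (-s * t) * ∫ τ in (0 : ℝ)..t, a (t - τ) * b τ =
        (∫ t in Ioi (0 : ℝ), Real.exp (-s * t) * a t) *
          ∫ t in Ioi (0 : ℝ), Real.exp (-s * t) * b t := by
  have e : ∀ t, Real.exp (-s * t) * ∫ τ in (0 : ℝ)..t, a (t - τ) * b τ =
      ∫ τ in (0 : ℝ)..t, ContinuousLinearMap.mul ℝ ℝ (Real.exp (-s * τ) * b τ)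
        (Real.exp (-s * (t - τ)) * a (t - τ)) := by
    intro t
    rw [← intervalIntegral.integral_const_mul]
    congr 1 with τ
    simp only [ContinuousLinearMap.mul_apply']
    have : Real.exp (-s * t) = Real.exp (-s * τ) * Real.exp (-s * (t - τ)) := by
      rw [← Real.exp_add]; ring_nf
    rw [this]; ring
  simp only [e]
  refine ⟨?_, ?_⟩
  · have := integrable_posConvolution (ν := volume) (μ := volume) hb ha (ContinuousLinearMap.mul ℝ ℝ)
    rw [← integrable_indicator_iff measurableSet_Ioi]
    exact this
  · rw [integral_posConvolution hb ha (ContinuousLinearMap.mul ℝ ℝ), ContinuousLinearMap.mul_apply',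
      mul_comm]

/-- The Volterra equation of the kernel `kernelB`. -/
theorem kernelD_eq_ae (hρ : ρ ∈ Ioo (0 : ℝ) 1) (hγ : 0 < γ) (hlam : 0 < lam) :
    ∀ᵐ t : ℝ, t ∈ Ioi 0 → kernelD ρ γ lam t = lam * kernelB ρ γ lam t + lam * γ * (caputoKernel ρ t -
      ∫ τ in (0 : ℝ)..t, caputoKernel ρ (t - τ) * kernelD ρ γ lam τ) := by
  set c : ℝ → ℝ := fun t => ∫ τ in (0 : ℝ)..t, caputoKernel ρ (t - τ) * kernelD ρ γ lam τ with hc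
  set h : ℝ → ℝ := fun t => kernelD ρ γ lam t - (lam * kernelB ρ γ lam t +
    lam * γ * (caputoKernel ρ t - c t)) with hh
  -- With `p = symbol s` this reads `1 - s/p = λ/p + λγ s^(ρ-1) (s/p)`, that is, `p - s = λ + λγ
  -- s^ρ`.
  have key : ∀ s : ℝ, 0 < s → IntegrableOn (fun t => Real.exp (-s * t) * h t) (Ioi 0) ∧
      ∫ t in Ioi (0 : ℝ), Real.exp (-s * t) * h t = 0 := by
    intro s hs
    obtain ⟨d1, d2⟩ := laplace_kernelD hρ hγ hlam hs
    obtain ⟨b1, b2⟩ := laplace_kernelB hρ hγ hlam hs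
    obtain ⟨g1, g2⟩ := laplace_caputoKernel hρ hs
    obtain ⟨c1, c2⟩ := laplace_conv g1 d1
    have e : (fun t => Real.exp (-s * t) * h t) = fun t =>
        Real.exp (-s * t) * kernelD ρ γ lam t - (lam * (Real.exp (-s * t) * kernelB ρ γ lam t) +
          lam * γ * (Real.exp (-s * t) * caputoKernel ρ t - Real.exp (-s * t) * c t)) := by
      ext t; rw [hh]; ring
    have i1 := (b1.const_mul lam)
    have i2 : IntegrableOn (fun t => lam * γ * (Real.exp (-s * t) * caputoKernel ρ t -
        Real.exp (-s * t) * c t)) (Ioi 0) := (g1.sub c1).const_mul (lam * γ)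
    have i3 : IntegrableOn (fun t => lam * (Real.exp (-s * t) * kernelB ρ γ lam t) +
        lam * γ * (Real.exp (-s * t) * caputoKernel ρ t - Real.exp (-s * t) * c t)) (Ioi 0) :=
      i1.add i2
    rw [e]
    refine ⟨d1.sub i3, ?_⟩
    rw [integral_sub d1 i3, integral_add i1 i2, integral_const_mul, integral_const_mul,
      integral_sub g1 c1, c2, d2, b2, g2]
    have hp := symbol_pos (ρ := ρ) hγ hlam hs
    have hp' : s + lam * γ * s ^ ρ + lam ≠ 0 := hp.ne'
    rw [symbol]
    field_simp
    ring
  have := ae_eq_zero_of_laplace_eq_zero (h := h) (by simpa using (key 1 one_pos).1) (fun n => by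
    have h1 := (key (n + 1) (by positivity)).2
    refine Eq.trans ?_ h1
    congr 1 with t
    rw [← mul_assoc, ← Real.exp_nat_mul, ← Real.exp_add]
    ring_nf)
  filter_upwards [this] with t ht h0
  exact sub_eq_zero.1 (ht h0)

end Kernels

/-! ### One-sided convolutions on a bounded interval -/

section Volterra

open scoped Convolution

variable {E : Type*} [NormedAddCommGroup E] [NormedSpace ℝ E]

/-- The one-sided convolution `∫₀ᵗ a(t - τ) f(τ) dτ`. -/
noncomputable def volterra (a : ℝ → ℝ) (f : ℝ → E) (t : ℝ) : E :=
  ∫ τ in (0 : ℝ)..t, a (t - τ) • f τ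

lemma volterra_eq_swap (a : ℝ → ℝ) (f : ℝ → E) (t : ℝ) :
    volterra a f t = ∫ τ in (0 : ℝ)..t, a τ • f (t - τ) := by
  have := intervalIntegral.integral_comp_sub_left (a := 0) (b := t) (fun τ => a τ • f (t - τ)) t
  simpa [volterra] using this

variable {T t : ℝ} {a b : ℝ → ℝ} {f g : ℝ → E}

lemma volterra_congr_left (ht : t ∈ Icc 0 T) (h : ∀ᵐ x, x ∈ Ioc 0 T → a x = b x) :
    volterra a f t = volterra b f t := by
  rw [volterra_eq_swap, volterra_eq_swap]
  refine intervalIntegral.integral_congr_ae ?_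
  filter_upwards [h] with x hx hx'
  rw [uIoc_of_le ht.1] at hx'
  rw [hx ⟨hx'.1, hx'.2.trans ht.2⟩]

lemma volterra_congr_right (ht : t ∈ Icc 0 T) (h : ∀ x ∈ Ioc 0 T, f x = g x) :
    volterra a f t = volterra a g t := by
  refine intervalIntegral.integral_congr_ae (Eventually.of_forall fun x hx' => ?_)
  rw [uIoc_of_le ht.1] at hx'
  simp only [h x ⟨hx'.1, hx'.2.trans ht.2⟩]

lemma intervalIntegrable_volterra (ht : t ∈ Icc 0 T) (ha : IntegrableOn a (Ioc 0 T))
    (hf : ContinuousOn f (Icc 0 T)) : IntervalIntegrable (fun τ => a (t - τ) • f τ) volume 0 t := by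
  have h1 : IntervalIntegrable a volume 0 t := by
    rw [intervalIntegrable_iff_integrableOn_Ioc_of_le ht.1]
    exact ha.mono_set (Ioc_subset_Ioc_right ht.2)
  have h2 := (h1.comp_sub_left t).symm
  simp only [sub_zero, sub_self] at h2
  refine h2.smul_continuousOn ?_
  rw [uIcc_of_le ht.1]
  exact hf.mono (Icc_subset_Icc_right ht.2)

lemma volterra_sub_right (ht : t ∈ Icc 0 T) (ha : IntegrableOn a (Ioc 0 T))
    (hf : ContinuousOn f (Icc 0 T)) (hg : ContinuousOn g (Icc 0 T)) :
    volterra a (fun x => f x - g x) t = volterra a f t - volterra a g t := by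
  simp only [volterra, smul_sub]
  exact intervalIntegral.integral_sub (intervalIntegrable_volterra ht ha hf)
    (intervalIntegrable_volterra ht ha hg)

lemma volterra_sub_left (ht : t ∈ Icc 0 T) (ha : IntegrableOn a (Ioc 0 T))
    (hb : IntegrableOn b (Ioc 0 T)) (hf : ContinuousOn f (Icc 0 T)) :
    volterra (fun x => a x - b x) f t = volterra a f t - volterra b f t := by
  simp only [volterra, sub_smul]
  exact intervalIntegral.integral_sub (intervalIntegrable_volterra ht ha hf)
    (intervalIntegrable_volterra ht hb hf)

lemma volterra_const_mul_left (c : ℝ) : volterra (fun x => c * a x) f t = c • volterra a f t := by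
  simp only [volterra, mul_smul]
  exact intervalIntegral.integral_smul c _

lemma volterra_one : volterra (fun _ => 1) f t = ∫ τ in (0 : ℝ)..t, f τ := by
  simp [volterra]

/-- Transfers associativity from the full line. The second factor `k` is prescribed only up to `T`,
so that it may itself be a convolution, which need not vanish beyond `T`. -/
lemma volterra_eq_convolution (hT : t ≤ T) {k : ℝ → E}
    (hk0 : ∀ x ≤ 0, k x = 0) (hk : ∀ x ∈ Ioc 0 T, k x = f x) (h0 : 0 ≤ t) :
    volterra a f t = (indicator (Ioc 0 T) a ⋆[ContinuousLinearMap.lsmul ℝ ℝ, volume] k) t := by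
  rw [volterra_eq_swap, intervalIntegral.integral_of_le h0, ← integral_indicator measurableSet_Ioc,
    convolution]
  refine integral_congr_ae ?_
  -- The point `x = t` is discarded: there `k 0 = 0`, while `f 0` is arbitrary.
  filter_upwards [compl_mem_ae_iff.2 (measure_singleton t)] with x hx
  have hx' : x ≠ t := hx
  simp only [ContinuousLinearMap.lsmul_apply]
  by_cases h1 : x ∈ Ioc 0 t
  · have h2 : x ∈ Ioc 0 T := ⟨h1.1, h1.2.trans hT⟩
    have h3 : x < t := lt_of_le_of_ne h1.2 hx'
    rw [indicator_of_mem h1, indicator_of_mem h2, hk _ ⟨by linarith, by linarith [h1.1]⟩]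
  · rw [indicator_of_notMem h1]
    by_cases h2 : x ≤ 0
    · rw [indicator_of_notMem (fun h => absurd h.1 (not_lt.2 h2)), zero_smul]
    · have h3 : t < x := by
        by_contra h
        exact h1 ⟨not_le.1 h2, not_lt.1 h⟩
      rw [hk0 _ (by linarith), smul_zero]

lemma convolution_indicator_eq_zero (t : ℝ) (ht : t ≤ 0) :
    (indicator (Ioc 0 T) a ⋆[ContinuousLinearMap.lsmul ℝ ℝ, volume] indicator (Ioc 0 T) f) t = 0 := by
  rw [convolution]
  refine integral_eq_zero_of_ae (Eventually.of_forall fun x => ?_)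
  simp only [ContinuousLinearMap.lsmul_apply, Pi.zero_apply]
  by_cases h2 : x ≤ 0
  · rw [indicator_of_notMem (fun h => absurd h.1 (not_lt.2 h2)), zero_smul]
  · rw [indicator_of_notMem (s := Ioc 0 T) (f := f) (fun h => by linarith [h.1]), smul_zero]

lemma volterra_eq_convolution_indicator (ht : t ∈ Icc 0 T) :
    volterra a f t =
      (indicator (Ioc 0 T) a ⋆[ContinuousLinearMap.lsmul ℝ ℝ, volume] indicator (Ioc 0 T) f) t :=
  volterra_eq_convolution ht.2 (fun _ hx => indicator_of_notMem (fun h => absurd h.1 (not_lt.2 hx)) _)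
    (fun _ hx => indicator_of_mem hx _) ht.1

lemma integrableOn_volterra (ha : IntegrableOn a (Ioc 0 T)) (hf : IntegrableOn f (Ioc 0 T)) :
    IntegrableOn (volterra a f) (Ioc 0 T) := by
  have ha' := (integrable_indicator_iff measurableSet_Ioc).2 ha
  have hf' := (integrable_indicator_iff measurableSet_Ioc).2 hf
  have := (ha'.integrable_convolution (ContinuousLinearMap.lsmul ℝ ℝ) hf').integrableOn (s := Ioc 0 T)
  refine this.congr_fun (fun x hx => ?_) measurableSet_Ioc
  exact (volterra_eq_convolution_indicator ⟨hx.1.le, hx.2⟩).symm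

lemma volterra_assoc [CompleteSpace E] (ht : t ∈ Icc 0 T) (ha : IntegrableOn a (Ioc 0 T))
    (hb : IntegrableOn b (Ioc 0 T)) (hf : ContinuousOn f (Icc 0 T)) :
    volterra a (volterra b f) t = volterra (volterra a b) f t := by
  set a' := indicator (Ioc 0 T) a with ha'
  set b' := indicator (Ioc 0 T) b with hb'
  set f' := indicator (Ioc 0 T) f with hf'
  have ia : Integrable a' := (integrable_indicator_iff measurableSet_Ioc).2 ha
  have ib : Integrable b' := (integrable_indicator_iff measurableSet_Ioc).2 hb
  have iF : Integrable f' := (integrable_indicator_iff measurableSet_Ioc).2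
    (hf.integrableOn_Icc.mono_set Ioc_subset_Icc_self)
  obtain ⟨M, hM⟩ := isCompact_Icc.exists_bound_of_continuousOn hf
  have hM' : ∀ x, ‖f' x‖ ≤ |M| := by
    intro x
    by_cases hx : x ∈ Ioc 0 T
    · rw [hf', indicator_of_mem hx]
      exact (hM x ⟨hx.1.le, hx.2⟩).trans (le_abs_self M)
    · rw [hf', indicator_of_notMem hx, norm_zero]; positivity
  have hassoc := convolution_assoc (ContinuousLinearMap.lsmul ℝ ℝ : ℝ →L[ℝ] ℝ →L[ℝ] ℝ)
    (ContinuousLinearMap.lsmul ℝ ℝ : ℝ →L[ℝ] E →L[ℝ] E)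
    (ContinuousLinearMap.lsmul ℝ ℝ : ℝ →L[ℝ] E →L[ℝ] E)
    (ContinuousLinearMap.lsmul ℝ ℝ : ℝ →L[ℝ] E →L[ℝ] E) (fun x y z => by
      simp only [ContinuousLinearMap.lsmul_apply, smul_eq_mul, mul_smul])
    (μ := volume) (ν := volume) (x₀ := t)
    ia.aestronglyMeasurable ib.aestronglyMeasurable iF.aestronglyMeasurable
    (ia.ae_convolution_exists _ ib) (ib.norm.ae_convolution_exists _ iF.norm) (by
      -- Existence is needed at the given `t`, not almost everywhere. Boundedness of `f'` makes the
      -- inner convolution bounded, which suffices.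
      have im := ib.norm.integrable_convolution (ContinuousLinearMap.mul ℝ ℝ) iF.norm
      have hm := im.aestronglyMeasurable.comp_quasiMeasurePreserving
        (quasiMeasurePreserving_sub_left_of_right_invariant volume t)
      unfold ConvolutionExistsAt
      simp only [ContinuousLinearMap.mul_apply']
      refine Integrable.mul_bdd (c := ∫ x, ‖b' x‖ * |M|) ia.norm hm ?_
      refine Eventually.of_forall fun x => ?_
      refine norm_integral_le_of_norm_le (ib.norm.mul_const _) (Eventually.of_forall fun y => ?_)
      simp only [ContinuousLinearMap.mul_apply', norm_mul, norm_norm]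
      exact mul_le_mul_of_nonneg_left (hM' _) (norm_nonneg _))
  rw [volterra_eq_convolution ht.2 (k := b' ⋆[ContinuousLinearMap.lsmul ℝ ℝ, volume] f')
    convolution_indicator_eq_zero
    (fun x hx => (volterra_eq_convolution_indicator ⟨hx.1.le, hx.2⟩).symm) ht.1, ← hassoc,
    volterra_eq_convolution_indicator ht]
  -- The convolution of `a'` and `b'` is not cut off at `T`, but for `x > T` the factor `f' (t - x)`
  -- vanishes since `t ≤ T`.
  refine integral_congr_ae (Eventually.of_forall fun x => ?_)
  simp only [ContinuousLinearMap.lsmul_apply]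
  by_cases hx : x ∈ Ioc 0 T
  · rw [indicator_of_mem hx, volterra_eq_convolution_indicator ⟨hx.1.le, hx.2⟩]
  · rw [indicator_of_notMem hx, zero_smul]
    by_cases hx0 : x ≤ 0
    · rw [convolution_indicator_eq_zero x hx0, zero_smul]
    · rw [hf', indicator_of_notMem, smul_zero]
      exact fun h => hx ⟨not_le.1 hx0, by linarith [h.1, ht.2]⟩

end Volterra

/-! ### The scalar fractional equation: solution formula and uniqueness -/

section ScalarProblem

variable {E : Type*} [NormedAddCommGroup E] [NormedSpace ℝ E]
variable {ρ γ lam T : ℝ}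

lemma integrableOn_caputoKernel (hρ : ρ ∈ Ioo (0 : ℝ) 1) : IntegrableOn (caputoKernel ρ) (Ioc 0 T) := by
  by_cases hT : 0 ≤ T
  · rw [← intervalIntegrable_iff_integrableOn_Ioc_of_le hT]
    exact (intervalIntegral.intervalIntegrable_rpow' (by linarith [hρ.2])).const_mul _
  · rw [Ioc_eq_empty (fun h => hT h.le)]
    exact integrableOn_empty

lemma integrableOn_kernelB (hρ : ρ ∈ Ioo (0 : ℝ) 1) (hγ : 0 < γ) (hlam : 0 < lam) :
    IntegrableOn (kernelB ρ γ lam) (Ioc 0 T) := by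
  refine Measure.integrableOn_of_bounded (M := 1) (by simp) (by fun_prop) ?_
  filter_upwards [ae_restrict_mem measurableSet_Ioc] with t ht
  rw [Real.norm_of_nonneg (kernelB_nonneg hρ hγ hlam t)]
  exact kernelB_le_one hρ hγ hlam ht.1.le

/-- Solution formula of the scalar problem `w' + λ w + λγ D^ρ w = f`, `w(0) = 0`, in terms of the
derivative `z = w'`. -/
theorem scalar_solution [CompleteSpace E] (hρ : ρ ∈ Ioo (0 : ℝ) 1) (hγ : 0 < γ) (hlam : 0 < lam)
    (hT : 0 ≤ T) {f z : ℝ → E} (hf : ContinuousOn f (Icc 0 T)) (hz : ContinuousOn z (Icc 0 T))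
    (hzf : ∀ t ∈ Icc 0 T, z t = f t - volterra (kernelD ρ γ lam) f t) :
    ∀ t ∈ Icc 0 T, ∫ τ in (0 : ℝ)..t, z τ = volterra (kernelB ρ γ lam) f t ∧
      z t + lam • (∫ τ in (0 : ℝ)..t, z τ) + (lam * γ) • volterra (caputoKernel ρ) z t = f t := by
  have iD : IntegrableOn (kernelD ρ γ lam) (Ioc 0 T) := (integral_kernelD hρ hγ hlam hT).1
  have iB : IntegrableOn (kernelB ρ γ lam) (Ioc 0 T) := integrableOn_kernelB hρ hγ hlam
  have iG : IntegrableOn (caputoKernel ρ) (Ioc 0 T) := integrableOn_caputoKernel hρ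
  have i1 : IntegrableOn (fun _ => (1 : ℝ)) (Ioc 0 T) := by simp
  have hc : ContinuousOn (volterra (kernelD ρ γ lam) f) (Icc 0 T) :=
    (hf.sub hz).congr fun t ht => by rw [Pi.sub_apply, hzf t ht, sub_sub_cancel]
  -- By associativity `a*z = (a - a*D)*f`. For `a = 1` the bracket is `B`; for the Caputo kernel the
  -- Volterra equation identifies it.
  have key : ∀ a : ℝ → ℝ, IntegrableOn a (Ioc 0 T) → ∀ t ∈ Icc 0 T,
      volterra a z t = volterra (fun x => a x - volterra a (kernelD ρ γ lam) x) f t := by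
    intro a ha t ht
    rw [volterra_congr_right ht (fun x hx => hzf x ⟨hx.1.le, hx.2⟩), volterra_sub_right ht ha hf hc,
      volterra_assoc ht ha iD hf, volterra_sub_left ht ha (integrableOn_volterra ha iD) hf]
  intro t ht
  have hw : ∫ τ in (0 : ℝ)..t, z τ = volterra (kernelB ρ γ lam) f t := by
    rw [← volterra_one, key _ i1 t ht]
    refine volterra_congr_left ht (Eventually.of_forall fun x hx => ?_)
    rw [volterra_one, (integral_kernelD hρ hγ hlam hx.1.le).2]
    ring
  refine ⟨hw, ?_⟩
  have h3 : (lam * γ) • volterra (caputoKernel ρ) z t =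
      volterra (kernelD ρ γ lam) f t - lam • volterra (kernelB ρ γ lam) f t := by
    rw [key _ iG t ht, ← volterra_const_mul_left, ← volterra_const_mul_left,
      ← volterra_sub_left ht iD (iB.const_mul lam) hf]
    refine volterra_congr_left ht ?_
    filter_upwards [kernelD_eq_ae hρ hγ hlam] with x hx hx'
    have h4 : kernelD ρ γ lam x = lam * kernelB ρ γ lam x + lam * γ * (caputoKernel ρ x -
      volterra (caputoKernel ρ) (kernelD ρ γ lam) x) := hx hx'.1
    linarith
  rw [h3, hw, hzf t ht]
  abel

/-- Uniqueness for the homogeneous scalar problem. -/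
theorem scalar_uniqueness (hρ : ρ ∈ Ioo (0 : ℝ) 1) (hγ : 0 < γ) (hlam : 0 < lam)
    {q : ℝ → E} (hq : IntegrableOn q (Ioc 0 T))
    (heq : ∀ t ∈ Ioc 0 T, q t + lam • (∫ τ in (0 : ℝ)..t, q τ) +
      (lam * γ) • volterra (caputoKernel ρ) q t = 0) :
    ∀ t ∈ Icc 0 T, ∫ τ in (0 : ℝ)..t, q τ = 0 := by
  set Q : ℝ → ℝ := indicator (Ioc 0 T) fun t => ‖q t‖ with hQ
  have hQ0 : ∀ t, 0 ≤ Q t := fun t => indicator_nonneg (fun _ _ => norm_nonneg _) t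
  have iQ : Integrable Q := (integrable_indicator_iff measurableSet_Ioc).2 hq.norm
  have hQeq : ∀ t ∈ Ioc 0 T, Q t = ‖q t‖ := fun t ht => indicator_of_mem ht _
  have hineq : ∀ t ∈ Ioi (0 : ℝ), Q t ≤ lam * (∫ τ in (0 : ℝ)..t, (1 : ℝ) * Q τ) +
      lam * γ * ∫ τ in (0 : ℝ)..t, caputoKernel ρ (t - τ) * Q τ := by
    intro t ht
    have ht0 : (0 : ℝ) < t := ht
    by_cases htT : t ≤ T
    · have htI : t ∈ Ioc 0 T := ⟨ht, htT⟩
      have e1 : q t = -(lam • (∫ τ in (0 : ℝ)..t, q τ) +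
          (lam * γ) • volterra (caputoKernel ρ) q t) := by
        rw [eq_neg_iff_add_eq_zero, ← add_assoc]; exact heq t htI
      rw [hQeq t htI, e1, norm_neg]
      refine (norm_add_le _ _).trans ?_
      rw [norm_smul, norm_smul, Real.norm_of_nonneg hlam.le,
        Real.norm_of_nonneg (mul_pos hlam hγ).le]
      refine add_le_add (mul_le_mul_of_nonneg_left ?_ hlam.le)
        (mul_le_mul_of_nonneg_left ?_ (mul_pos hlam hγ).le)
      · refine (intervalIntegral.norm_integral_le_integral_norm ht0.le).trans_eq ?_
        refine intervalIntegral.integral_congr_ae (Eventually.of_forall fun x hx => ?_)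
        rw [uIoc_of_le ht0.le] at hx
        rw [hQeq x ⟨hx.1, hx.2.trans htT⟩, one_mul]
      · refine (intervalIntegral.norm_integral_le_integral_norm ht0.le).trans_eq ?_
        refine intervalIntegral.integral_congr_ae (Eventually.of_forall fun x hx => ?_)
        rw [uIoc_of_le ht0.le] at hx
        rw [hQeq x ⟨hx.1, hx.2.trans htT⟩, norm_smul,
          Real.norm_of_nonneg (caputoKernel_nonneg hρ (by linarith [hx.2]))]
    · rw [hQ, indicator_of_notMem (fun h => htT h.2), ← hQ]
      have h1 : 0 ≤ ∫ τ in (0 : ℝ)..t, (1 : ℝ) * Q τ :=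
        intervalIntegral.integral_nonneg ht0.le fun x _ => by simpa using hQ0 x
      have h2 : 0 ≤ ∫ τ in (0 : ℝ)..t, caputoKernel ρ (t - τ) * Q τ :=
        intervalIntegral.integral_nonneg ht0.le fun x hx =>
          mul_nonneg (caputoKernel_nonneg hρ (by linarith [hx.2])) (hQ0 x)
      positivity
  -- The left side is the Laplace transform at `μ` of the total kernel `λ + λγg`, so the weighted
  -- norm `J` of `q` satisfies `J ≤ θJ` with `θ < 1`.
  obtain ⟨μ, hμ0, hμ⟩ : ∃ μ : ℝ, 0 < μ ∧ lam * μ⁻¹ + lam * γ * (μ ^ ρ / μ) < 1 := by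
    have h1 : Tendsto (fun s : ℝ => s ^ (-(1 - ρ))) atTop (𝓝 0) :=
      tendsto_rpow_neg_atTop (by linarith [hρ.2])
    have h3 := (tendsto_inv_atTop_zero.const_mul lam).add (h1.const_mul (lam * γ))
    simp only [mul_zero, add_zero] at h3
    obtain ⟨μ, h4, h5⟩ := ((h3.eventually_lt_const one_pos).and (eventually_gt_atTop 0)).exists
    refine ⟨μ, h5, ?_⟩
    rwa [neg_sub, Real.rpow_sub_one h5.ne'] at h4
  have iQμ : IntegrableOn (fun t => Real.exp (-μ * t) * Q t) (Ioi 0) := by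
    refine Integrable.bdd_mul (c := 1) iQ.integrableOn (by fun_prop) ?_
    filter_upwards [ae_restrict_mem measurableSet_Ioi] with r hr
    rw [Real.norm_of_nonneg (Real.exp_pos _).le]
    refine Real.exp_le_one_iff.2 ?_
    have : (0 : ℝ) < r := hr
    nlinarith
  set J := ∫ t in Ioi (0 : ℝ), Real.exp (-μ * t) * Q t with hJ
  have hJ0 : 0 ≤ J := setIntegral_nonneg measurableSet_Ioi fun t _ =>
    mul_nonneg (Real.exp_pos _).le (hQ0 t)
  have hexp := integrableOn_exp_neg_mul hμ0
  have hg := laplace_caputoKernel hρ hμ0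
  have hone : IntegrableOn (fun t => Real.exp (-μ * t) * (fun _ => (1 : ℝ)) t) (Ioi 0) := by
    simpa using hexp.1
  have c1 := laplace_conv (a := fun _ => 1) hone iQμ
  have c2 := laplace_conv hg.1 iQμ
  have hJle : J ≤ (lam * μ⁻¹ + lam * γ * (μ ^ ρ / μ)) * J := by
    have h1 : J ≤ ∫ t in Ioi (0 : ℝ),
        (lam * (Real.exp (-μ * t) * ∫ τ in (0 : ℝ)..t, (1 : ℝ) * Q τ) +
          lam * γ * (Real.exp (-μ * t) * ∫ τ in (0 : ℝ)..t, caputoKernel ρ (t - τ) * Q τ)) := by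
      refine setIntegral_mono_on iQμ ((c1.1.const_mul _).add (c2.1.const_mul _)) measurableSet_Ioi
        fun t ht => ?_
      refine (mul_le_mul_of_nonneg_left (hineq t ht) (Real.exp_pos (-μ * t)).le).trans_eq ?_
      ring
    rw [integral_add (c1.1.const_mul _) (c2.1.const_mul _), integral_const_mul, integral_const_mul,
      c1.2, c2.2, hg.2] at h1
    simp only [mul_one] at h1
    rw [hexp.2] at h1
    linarith
  have hJz : J = 0 := by
    by_contra hne
    have : 0 < J := lt_of_le_of_ne hJ0 (Ne.symm hne)
    nlinarith
  have hae := (setIntegral_eq_zero_iff_of_nonneg_ae (Eventually.of_forall fun t =>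
    mul_nonneg (Real.exp_pos _).le (hQ0 t)) iQμ).1 hJz
  rw [EventuallyEq, ae_restrict_iff' measurableSet_Ioi] at hae
  intro t ht
  refine intervalIntegral.integral_zero_ae ?_
  filter_upwards [hae] with x hx hx'
  rw [uIoc_of_le ht.1] at hx'
  have h1 := (mul_eq_zero.1 (hx hx'.1)).resolve_left (Real.exp_pos _).ne'
  rw [hQeq x ⟨hx'.1, hx'.2.trans ht.2⟩] at h1
  exact norm_eq_zero.1 h1

end ScalarProblem

/-! ### Coefficients and diagonal operators in a Hilbert basis -/

section HilbertBasis

variable {𝕜 : Type*} [RCLike 𝕜] {H : Type*} [NormedAddCommGroup H] [InnerProductSpace 𝕜 H]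
  (v : HilbertBasis ℕ 𝕜 H)

lemma hasSum_norm_inner_sq (x : H) : HasSum (fun k => ‖inner 𝕜 (v k) x‖ ^ 2) (‖x‖ ^ 2) := by
  have h := lp.hasSum_norm (p := 2) (by norm_num) (v.repr x)
  simp only [ENNReal.toReal_ofNat, LinearIsometryEquiv.norm_map, v.repr_apply_apply] at h
  exact_mod_cast h

lemma eq_of_inner_eq {x y : H} (h : ∀ k, inner 𝕜 (v k) x = inner 𝕜 (v k) y) : x = y := by
  apply v.repr.injective
  ext k
  rw [v.repr_apply_apply, v.repr_apply_apply, h]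

lemma exists_inner_eq {a : ℕ → 𝕜} (ha : Summable fun k => ‖a k‖ ^ 2) :
    ∃ y : H, ∀ k, inner 𝕜 (v k) y = a k := by
  have hmem : Memℓp a 2 := by
    rw [memℓp_gen_iff (by norm_num)]
    simp only [ENNReal.toReal_ofNat]
    exact_mod_cast ha
  refine ⟨v.repr.symm ⟨a, hmem⟩, fun k => ?_⟩
  rw [← v.repr_apply_apply, LinearIsometryEquiv.apply_symm_apply]

/-- A bounded sequence defines a bounded diagonal operator. -/
lemma exists_diagonal {c : ℕ → ℝ} {C : ℝ} (hc : ∀ k, |c k| ≤ C) :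
    ∃ D : H →L[𝕜] H, (∀ x k, inner 𝕜 (v k) (D x) = (c k : 𝕜) * inner 𝕜 (v k) x) ∧
      ∀ x, ‖D x‖ ≤ C * ‖x‖ := by
  have hC : 0 ≤ C := (abs_nonneg _).trans (hc 0)
  have hle : ∀ x k, ‖(c k : 𝕜) * inner 𝕜 (v k) x‖ ^ 2 ≤ C ^ 2 * ‖inner 𝕜 (v k) x‖ ^ 2 := by
    intro x k
    rw [norm_mul, mul_pow, RCLike.norm_ofReal]
    gcongr
    exact hc k
  have hs : ∀ x, Summable fun k => ‖(c k : 𝕜) * inner 𝕜 (v k) x‖ ^ 2 := fun x =>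
    Summable.of_nonneg_of_le (fun k => by positivity) (hle x)
      ((hasSum_norm_inner_sq v x).summable.mul_left _)
  choose D hD using fun x => exists_inner_eq v (hs x)
  have hn : ∀ x, ‖D x‖ ≤ C * ‖x‖ := by
    intro x
    refine le_of_sq_le_sq ?_ (by positivity)
    rw [mul_pow]
    refine hasSum_le (fun k => ?_) (hasSum_norm_inner_sq v (D x))
      ((hasSum_norm_inner_sq v x).mul_left _)
    rw [hD]
    exact hle x k
  refine ⟨LinearMap.mkContinuous
    { toFun := D
      map_add' := fun x y => eq_of_inner_eq v fun k => by
        rw [inner_add_right, hD, hD, hD, inner_add_right, mul_add]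
      map_smul' := fun r x => eq_of_inner_eq v fun k => by
        rw [RingHom.id_apply, inner_smul_right, hD, hD, inner_smul_right]; ring } C hn, hD, hn⟩

end HilbertBasis

/-! ### The self-adjoint operator in its eigenbasis -/

section SelfAdjoint

variable {𝕜 : Type*} [RCLike 𝕜] {H : Type*} [NormedAddCommGroup H] [InnerProductSpace 𝕜 H]
  {A : H →ₗ.[𝕜] H} {v : HilbertBasis ℕ 𝕜 H} {lam : ℕ → ℝ}

lemma opApply_of_mem {x : H} (hx : x ∈ A.domain) : opApply A x = A ⟨x, hx⟩ := by
  rw [opApply, dif_pos hx]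

variable [CompleteSpace H]

lemma inner_opApply (hA : IsSelfAdjoint A)
    (hv : ∀ k, ∃ hk : v k ∈ A.domain, A ⟨v k, hk⟩ = (lam k : 𝕜) • v k) {x : H}
    (hx : x ∈ A.domain) (k : ℕ) :
    inner 𝕜 (v k) (opApply A x) = (lam k : 𝕜) * inner 𝕜 (v k) x := by
  obtain ⟨hk, hAk⟩ := hv k
  have h := LinearPMap.adjoint_isFormalAdjoint hA.dense_domain
  rw [LinearPMap.isSelfAdjoint_def.1 hA] at h
  have h1 := h ⟨v k, hk⟩ ⟨x, hx⟩
  rw [hAk, inner_smul_left, RCLike.conj_ofReal] at h1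
  rw [opApply_of_mem hx]
  exact h1.symm

/-- By Parseval `y` represents `z ↦ (x, Az)`, so `x` lies in the domain of the adjoint, which is
that of `A`. Membership in the domain thus reduces to exhibiting a vector with coefficients `λ_k
x_k`. -/
lemma opApply_eq_of_inner_eq (hA : IsSelfAdjoint A)
    (hv : ∀ k, ∃ hk : v k ∈ A.domain, A ⟨v k, hk⟩ = (lam k : 𝕜) • v k) {x y : H}
    (h : ∀ k, inner 𝕜 (v k) y = (lam k : 𝕜) * inner 𝕜 (v k) x) :
    x ∈ A.domain ∧ opApply A x = y := by
  have hx : x ∈ A.domain := by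
    have : x ∈ A.adjoint.domain := by
      refine LinearPMap.mem_adjoint_domain_of_exists x ⟨y, fun z => ?_⟩
      rw [← v.tsum_inner_mul_inner, ← v.tsum_inner_mul_inner]
      congr 1 with k
      have h2 := inner_opApply hA hv z.2 k
      rw [opApply_of_mem z.2] at h2
      rw [h2, ← inner_conj_symm, h k, map_mul, RCLike.conj_ofReal, inner_conj_symm]
      ring
    rwa [LinearPMap.isSelfAdjoint_def.1 hA] at this
  exact ⟨hx, eq_of_inner_eq v fun k => by rw [inner_opApply hA hv hx, h]⟩

end SelfAdjoint

/-! ### Convolution with singular diagonal kernels -/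

section DiagonalConvolution

variable {𝕜 : Type*} [RCLike 𝕜] {H : Type*} [NormedAddCommGroup H] [InnerProductSpace 𝕜 H]
  [NormedSpace ℝ H] [IsScalarTower ℝ 𝕜 H]

/-- The Fourier coefficient as a real-linear map. -/
noncomputable def coeffCLM (v : HilbertBasis ℕ 𝕜 H) (k : ℕ) : H →L[ℝ] 𝕜 :=
  (innerSL 𝕜 (v k)).restrictScalars ℝ

@[simp]
lemma coeffCLM_apply (v : HilbertBasis ℕ 𝕜 H) (k : ℕ) (x : H) :
    coeffCLM v k x = inner 𝕜 (v k) x := rfl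

variable [CompleteSpace H]

/-- Convolution of a continuous function with a diagonal operator kernel having an integrable
singularity at `0`. -/
theorem exists_diagonal_volterra (v : HilbertBasis ℕ 𝕜 H) {m : ℕ → ℝ → ℝ}
    (hm : ∀ k, Measurable (m k)) {C δ T : ℝ} (hδ : 0 < δ) (hT : 0 ≤ T)
    (hC : ∀ k, ∀ t ∈ Ioc 0 T, |m k t| ≤ C * t ^ (δ - 1))
    {g : ℝ → H} (hg : ContinuousOn g (Icc 0 T)) :
    ∃ W : ℝ → H, ContinuousOn W (Icc 0 T) ∧
      (∀ t ∈ Icc 0 T, ∀ k, inner 𝕜 (v k) (W t) =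
        volterra (m k) (fun τ => inner 𝕜 (v k) (g τ)) t) ∧
      ∀ G, (∀ s ∈ Icc 0 T, ‖g s‖ ≤ G) → ∀ t ∈ Icc 0 T, ‖W t‖ ≤ C * (T ^ δ / δ) * G := by
  choose! D hD hDn using fun t (ht : t ∈ Ioc 0 T) => exists_diagonal v (fun k => hC k t ht)
  set gE : ℝ → H := IccExtend hT ((Icc 0 T).domRestrict g) with hgE
  have hgEc : Continuous gE := (continuousOn_iff_continuous_domRestrict.1 hg).Icc_extend'
  have hgEeq : ∀ s ∈ Icc 0 T, gE s = g s := fun s hs => IccExtend_of_mem hT _ hs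
  have hgEG : ∀ G, (∀ s ∈ Icc 0 T, ‖g s‖ ≤ G) → ∀ s, ‖gE s‖ ≤ G := by
    intro G hG s
    exact hG _ (projIcc 0 T hT s).2
  obtain ⟨G0, hG0⟩ := isCompact_Icc.exists_bound_of_continuousOn hg
  -- The indicator keeps the domain of integration fixed, so dominated convergence gives continuity
  -- in `t`; its jump at `σ = t` is a null set.
  set F : ℝ → ℝ → H := fun t => indicator (Iio t) fun σ => D σ (gE (t - σ)) with hF
  have hFm : ∀ t, AEStronglyMeasurable (F t) (volume.restrict (Ioc 0 T)) := by
    intro t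
    refine AEStronglyMeasurable.indicator ?_ measurableSet_Iio
    -- The operators `D σ` are chosen separately for each `σ`; measurability comes from the partial
    -- sums of the eigenvector expansion.
    refine aestronglyMeasurable_of_tendsto_ae atTop (f := fun (N : ℕ) σ =>
      ∑ k ∈ Finset.range N, ((m k σ : 𝕜) * inner 𝕜 (v k) (gE (t - σ))) • v k) (fun N => ?_) ?_
    · refine Finset.aestronglyMeasurable_fun_sum _ fun k _ => ?_
      refine AEStronglyMeasurable.smul (AEStronglyMeasurable.mul ?_ ?_) aestronglyMeasurable_const
      · exact (RCLike.measurable_ofReal.comp (hm k)).aestronglyMeasurable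
      · exact Continuous.aestronglyMeasurable (by fun_prop)
    · filter_upwards [ae_restrict_mem measurableSet_Ioc] with σ hσ
      have := (v.hasSum_repr (D σ (gE (t - σ)))).tendsto_sum_nat
      simpa only [v.repr_apply_apply, hD σ hσ] using this
  have hFb : ∀ G, (∀ s ∈ Icc 0 T, ‖g s‖ ≤ G) → ∀ t, ∀ᵐ σ ∂(volume.restrict (Ioc 0 T)),
      ‖F t σ‖ ≤ C * G * σ ^ (δ - 1) := by
    intro G hG t
    filter_upwards [ae_restrict_mem measurableSet_Ioc] with σ hσ
    refine (norm_indicator_le_norm_self _ _).trans ?_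
    have h0 : 0 ≤ C * σ ^ (δ - 1) := (abs_nonneg _).trans (hC 0 σ hσ)
    refine (hDn σ hσ _).trans ((mul_le_mul_of_nonneg_left (hgEG G hG _) h0).trans_eq ?_)
    ring
  have hint : IntervalIntegrable (fun σ : ℝ => σ ^ (δ - 1)) volume 0 T :=
    intervalIntegral.intervalIntegrable_rpow' (by linarith)
  have hbi : ∀ G, Integrable (fun σ : ℝ => C * G * σ ^ (δ - 1)) (volume.restrict (Ioc 0 T)) :=
    fun G => ((intervalIntegrable_iff_integrableOn_Ioc_of_le hT).1 hint).const_mul _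
  have hFi : ∀ t, IntegrableOn (F t) (Ioc 0 T) := fun t => (hbi G0).mono' (hFm t) (hFb G0 hG0 t)
  refine ⟨fun t => ∫ σ in Ioc 0 T, F t σ, ?_, ?_, ?_⟩
  · refine continuousOn_of_forall_continuousAt fun t0 _ => ?_
    refine continuousAt_of_dominated (Eventually.of_forall hFm)
      (Eventually.of_forall (hFb G0 hG0)) (hbi G0) ?_
    filter_upwards [compl_mem_ae_iff.2 (measure_singleton t0)] with σ hσ
    rcases lt_or_gt_of_ne (show σ ≠ t0 from hσ) with h | h
    · have hc : ContinuousAt (fun t => D σ (gE (t - σ))) t0 :=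
        Continuous.continuousAt (by fun_prop)
      refine hc.congr ?_
      filter_upwards [lt_mem_nhds h] with t ht
      exact (indicator_of_mem (s := Iio t) ht fun σ => D σ (gE (t - σ))).symm
    · have hc : ContinuousAt (fun _ : ℝ => (0 : H)) t0 := continuousAt_const
      refine hc.congr ?_
      filter_upwards [gt_mem_nhds h] with t ht
      exact (indicator_of_notMem (fun h' : σ ∈ Iio t => lt_asymm h' ht)
        fun σ => D σ (gE (t - σ))).symm
  · intro t ht k
    rw [← coeffCLM_apply, ← ContinuousLinearMap.integral_comp_comm _ (hFi t), volterra_eq_swap]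
    have e1 : Ioc 0 T ∩ Iio t = Ioo 0 t := by
      ext x
      simp only [mem_inter_iff, mem_Ioc, mem_Iio, mem_Ioo]
      exact ⟨fun h => ⟨h.1.1, h.2⟩, fun h => ⟨⟨h.1, h.2.le.trans ht.2⟩, h.2⟩⟩
    have e2 : ∀ σ, coeffCLM v k (F t σ) =
        indicator (Iio t) (fun σ => coeffCLM v k (D σ (gE (t - σ)))) σ := by
      intro σ
      simp only [hF, indicator]
      split_ifs <;> simp
    simp only [e2]
    rw [setIntegral_indicator measurableSet_Iio, e1, intervalIntegral.integral_of_le ht.1,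
      integral_Ioc_eq_integral_Ioo]
    refine setIntegral_congr_fun measurableSet_Ioo fun σ hσ => ?_
    have hσT : σ ∈ Ioc 0 T := ⟨hσ.1, hσ.2.le.trans ht.2⟩
    simp only [coeffCLM_apply]
    rw [hD σ hσT, hgEeq _ ⟨by linarith [hσ.2], by linarith [hσ.1, ht.2]⟩,
      RCLike.real_smul_eq_coe_mul]
  · intro G hG t _
    refine (norm_integral_le_of_norm_le (hbi G) (hFb G hG t)).trans_eq ?_
    rw [← intervalIntegral.integral_of_le hT, intervalIntegral.integral_const_mul,
      integral_rpow (Or.inl (by linarith))]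
    simp only [sub_add_cancel]
    rw [Real.zero_rpow hδ.ne']
    ring

end DiagonalConvolution

/-! ### Fractional domains and the function `A^ε f` -/

section FractionalSpaces

variable {𝕜 : Type*} [RCLike 𝕜] {H : Type*} [NormedAddCommGroup H] [InnerProductSpace 𝕜 H]
  {v : HilbertBasis ℕ 𝕜 H} {lam : ℕ → ℝ} {ε T : ℝ}

lemma norm_rpow_mul_sq (hlam : ∀ k, 0 < lam k) (k : ℕ) (z : 𝕜) :
    ‖((lam k ^ ε : ℝ) : 𝕜) * z‖ ^ 2 = lam k ^ (2 * ε) * ‖z‖ ^ 2 := by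
  rw [norm_mul, mul_pow, RCLike.norm_ofReal, sq_abs, ← Real.rpow_natCast (lam k ^ ε),
    ← Real.rpow_mul (hlam k).le, Nat.cast_ofNat, mul_comm ε 2]

/-- The function `A^ε f` attached to `f ∈ C([0, T]; D(A^ε))`. -/
lemma exists_fracPower (hlam : ∀ k, 0 < lam k) {f : ℝ → H} (hf : FracContinuous v lam ε T f) :
    ∃ g : ℝ → H, ContinuousOn g (Icc 0 T) ∧
      (∀ t ∈ Icc 0 T, ∀ k, inner 𝕜 (v k) (g t) = ((lam k ^ ε : ℝ) : 𝕜) * inner 𝕜 (v k) (f t)) ∧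
      ∀ t ∈ Icc 0 T, fracNorm v lam ε (f t) = ‖g t‖ := by
  have hex : ∀ t ∈ Icc 0 T, ∃ y : H, ∀ k, inner 𝕜 (v k) y =
      ((lam k ^ ε : ℝ) : 𝕜) * inner 𝕜 (v k) (f t) := by
    intro t ht
    refine exists_inner_eq v ?_
    simp only [norm_rpow_mul_sq hlam]
    exact hf.1 t ht
  choose! g hg using hex
  have hnorm : ∀ x y : H, (∀ k, inner 𝕜 (v k) y = ((lam k ^ ε : ℝ) : 𝕜) * inner 𝕜 (v k) x) →
      fracNorm v lam ε x = ‖y‖ := by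
    intro x y h
    have h2 := (hasSum_norm_inner_sq v y).tsum_eq
    simp only [h, norm_rpow_mul_sq hlam] at h2
    rw [fracNorm, h2, Real.sqrt_sq (norm_nonneg _)]
  refine ⟨g, fun s hs => ?_, hg, fun t ht => hnorm _ _ (hg t ht)⟩
  rw [ContinuousWithinAt, tendsto_iff_norm_sub_tendsto_zero]
  refine (hf.2 s hs).congr' ?_
  filter_upwards [self_mem_nhdsWithin] with t ht
  exact hnorm _ _ fun k => by rw [inner_sub_right, hg t ht, hg s hs, inner_sub_right, mul_sub]

end FractionalSpaces

/-! ### Coefficients of arbitrary solutions and uniqueness -/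

section Solutions

variable {𝕜 : Type*} [RCLike 𝕜] {H : Type*} [NormedAddCommGroup H] [InnerProductSpace 𝕜 H]
  [NormedSpace ℝ H] [IsScalarTower ℝ 𝕜 H]
  {A : H →ₗ.[𝕜] H} {v : HilbertBasis ℕ 𝕜 H} {lam : ℕ → ℝ} {ρ γ T : ℝ}

lemma intervalIntegrable_coeff_caputo {u q : ℝ → H} {t : ℝ}
    (h : IntervalIntegrable (caputoIntegrand ρ u t) volume 0 t)
    (ht : 0 ≤ t) (hq : ∀ ξ ∈ Ioo 0 t, deriv u ξ = q ξ) (k : ℕ) :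
    IntervalIntegrable (fun ξ => caputoKernel ρ (t - ξ) • inner 𝕜 (v k) (q ξ)) volume 0 t := by
  rw [intervalIntegrable_iff_integrableOn_Ioo_of_le ht] at h ⊢
  refine IntegrableOn.congr_fun (((coeffCLM v k).integrable_comp h).smul (Real.Gamma (1 - ρ))⁻¹)
    (fun ξ hξ => ?_) measurableSet_Ioo
  simp only [Pi.smul_apply, caputoIntegrand, caputoKernel, map_smul, coeffCLM_apply, hq ξ hξ,
    mul_smul]

variable [CompleteSpace H]

/-- The derivatives are compared on the open interval only: at the end points the two-sided `deriv`
may differ from the one-sided derivative, but these points are null. -/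
lemma inner_caputo {u q : ℝ → H} {t : ℝ} (h : IntervalIntegrable (caputoIntegrand ρ u t) volume 0 t)
    (ht : 0 ≤ t) (hq : ∀ ξ ∈ Ioo 0 t, deriv u ξ = q ξ) (k : ℕ) :
    inner 𝕜 (v k) (caputo ρ u t) = volterra (caputoKernel ρ) (fun ξ => inner 𝕜 (v k) (q ξ)) t := by
  rw [← coeffCLM_apply, caputo, map_smul, ← ContinuousLinearMap.intervalIntegral_comp_comm _ h,
    volterra, ← intervalIntegral.integral_smul, intervalIntegral.integral_of_le ht,
    intervalIntegral.integral_of_le ht, integral_Ioc_eq_integral_Ioo, integral_Ioc_eq_integral_Ioo]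
  refine setIntegral_congr_fun measurableSet_Ioo fun ξ hξ => ?_
  simp only [caputoIntegrand, caputoKernel, map_smul, coeffCLM_apply, hq ξ hξ, mul_smul]

/-- The Fourier coefficients of a solution solve the scalar problems. -/
lemma IsForwardSolution.coeff (hA : IsSelfAdjoint A)
    (hv : ∀ k, ∃ hk : v k ∈ A.domain, A ⟨v k, hk⟩ = (lam k : 𝕜) • v k) (hρ : 0 < ρ)
    (hT : 0 < T) {f U : ℝ → H} (hU : IsForwardSolution A ρ γ T f 0 U) (k : ℕ) :
    ∃ q : ℝ → 𝕜, IntegrableOn q (Ioc 0 T) ∧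
      (∀ t ∈ Icc 0 T, ∫ τ in (0 : ℝ)..t, q τ = inner 𝕜 (v k) (U t)) ∧
      (∀ t ∈ Ioc 0 T, IntervalIntegrable (fun τ => caputoKernel ρ (t - τ) • q τ) volume 0 t) ∧
      ∀ t ∈ Ioc 0 T, q t + lam k • (∫ τ in (0 : ℝ)..t, q τ) +
        (lam k * γ) • volterra (caputoKernel ρ) q t = inner 𝕜 (v k) (f t) := by
  have hder : ∀ t ∈ Ioo 0 T, HasDerivAt U (timeDeriv T U t) t := fun t ht =>
    (hU.differentiable t ⟨ht.1, ht.2.le⟩).hasDerivWithinAt.hasDerivAt (Icc_mem_nhds ht.1 ht.2)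
  -- Being a solution does not include integrability of `U'` near `0`. It follows from the Caputo
  -- integrand at `t = T` on multiplying by the bounded factor `(T - ξ)^ρ`.
  have hint : IntegrableOn (timeDeriv T U) (Ioc 0 T) := by
    have h1 := hU.caputo_exists T ⟨hT, le_rfl⟩
    have h2 : ContinuousOn (fun ξ : ℝ => (T - ξ) ^ ρ) (uIcc 0 T) :=
      ContinuousOn.rpow_const (by fun_prop) fun x hx => Or.inr hρ.le
    have h3 := (intervalIntegrable_iff_integrableOn_Ioo_of_le hT.le).1 (h1.continuousOn_smul h2)
    rw [integrableOn_Ioc_iff_integrableOn_Ioo]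
    refine h3.congr_fun (fun ξ hξ => ?_) measurableSet_Ioo
    have h4 : 0 < T - ξ := sub_pos.2 hξ.2
    simp only [caputoIntegrand]
    rw [smul_smul, ← Real.rpow_add h4, add_neg_cancel, Real.rpow_zero, one_smul, (hder ξ hξ).deriv]
  have hFTC : ∀ t ∈ Icc 0 T, ∫ τ in (0 : ℝ)..t, timeDeriv T U τ = U t := by
    intro t ht
    rw [intervalIntegral.integral_eq_sub_of_hasDerivAt_of_le ht.1
      (hU.continuousOn.mono (Icc_subset_Icc_right ht.2))
      (fun x hx => hder x ⟨hx.1, hx.2.trans_le ht.2⟩)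
      ((intervalIntegrable_iff_integrableOn_Ioc_of_le ht.1).2
        (hint.mono_set (Ioc_subset_Ioc_right ht.2))), hU.initial, sub_zero]
  have hw : ∀ t ∈ Icc 0 T, ∫ τ in (0 : ℝ)..t, inner 𝕜 (v k) (timeDeriv T U τ) =
      inner 𝕜 (v k) (U t) := by
    intro t ht
    simp only [← coeffCLM_apply]
    rw [ContinuousLinearMap.intervalIntegral_comp_comm, hFTC t ht]
    exact (intervalIntegrable_iff_integrableOn_Ioc_of_le ht.1).2
        (hint.mono_set (Ioc_subset_Ioc_right ht.2))
  have hdt : ∀ t ∈ Ioc 0 T, ∀ ξ ∈ Ioo 0 t, deriv U ξ = timeDeriv T U ξ := fun t ht ξ hξ =>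
    (hder ξ ⟨hξ.1, hξ.2.trans_le ht.2⟩).deriv
  refine ⟨fun t => inner 𝕜 (v k) (timeDeriv T U t), (coeffCLM v k).integrable_comp hint, hw,
    fun t ht => intervalIntegrable_coeff_caputo (hU.caputo_exists t ht) ht.1.le (hdt t ht) k,
    fun t ht => ?_⟩
  have hcap := inner_caputo (v := v) (hU.caputo_exists t ht) ht.1.le (hdt t ht) k
  have hγA : γ • caputo ρ U t ∈ A.domain := by
    rw [← algebraMap_smul 𝕜]
    exact A.domain.smul_mem _ (hU.caputo_mem_domain t ht)
  have heq := congrArg (coeffCLM v k) (hU.equation t ht)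
  rw [map_add, coeffCLM_apply, coeffCLM_apply, coeffCLM_apply,
    inner_opApply hA hv (A.domain.add_mem (hU.mem_domain t ht) hγA), inner_add_right,
    ← coeffCLM_apply v k (γ • _), map_smul, coeffCLM_apply, hcap] at heq
  rw [hw t ⟨ht.1.le, ht.2⟩, ← heq]
  simp only [RCLike.real_smul_eq_coe_mul]
  push_cast
  ring

theorem IsForwardSolution.eqOn (hA : IsSelfAdjoint A) (hlam : ∀ k, 0 < lam k)
    (hv : ∀ k, ∃ hk : v k ∈ A.domain, A ⟨v k, hk⟩ = (lam k : 𝕜) • v k)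
    (hρ : ρ ∈ Ioo (0 : ℝ) 1) (hγ : 0 < γ) (hT : 0 < T)
    {f U V : ℝ → H} (hU : IsForwardSolution A ρ γ T f 0 U) (hV : IsForwardSolution A ρ γ T f 0 V) :
    EqOn U V (Icc 0 T) := by
  intro t ht
  refine eq_of_inner_eq v fun k => ?_
  obtain ⟨p, hp, hpw, hpi, hpe⟩ := hU.coeff hA hv hρ.1 hT k
  obtain ⟨q, hq, hqw, hqi, hqe⟩ := hV.coeff hA hv hρ.1 hT k
  have hsub : ∀ s ∈ Icc 0 T, ∫ τ in (0 : ℝ)..s, (p τ - q τ) =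
      (∫ τ in (0 : ℝ)..s, p τ) - ∫ τ in (0 : ℝ)..s, q τ := fun s hs =>
    intervalIntegral.integral_sub
      ((intervalIntegrable_iff_integrableOn_Ioc_of_le hs.1).2
        (hp.mono_set (Ioc_subset_Ioc_right hs.2)))
      ((intervalIntegrable_iff_integrableOn_Ioc_of_le hs.1).2
        (hq.mono_set (Ioc_subset_Ioc_right hs.2)))
  have h0 := scalar_uniqueness hρ hγ (hlam k) (q := fun τ => p τ - q τ) (hp.sub hq) (fun s hs => by
    have h1 : volterra (caputoKernel ρ) (fun τ => p τ - q τ) s =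
        volterra (caputoKernel ρ) p s - volterra (caputoKernel ρ) q s := by
      simp only [volterra, smul_sub]
      exact intervalIntegral.integral_sub (hpi s hs) (hqi s hs)
    rw [hsub s ⟨hs.1.le, hs.2⟩, h1, smul_sub, smul_sub, ← sub_eq_zero.2 ((hpe s hs).trans
      (hqe s hs).symm)]
    abel) t ht
  rwa [hsub t ht, hpw t ht, hqw t ht, sub_eq_zero] at h0

end Solutions

/-! ### Construction of the solution and its bounds -/

section Existence

variable {𝕜 : Type*} [RCLike 𝕜] {H : Type*} [NormedAddCommGroup H] [InnerProductSpace 𝕜 H]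
  {A : H →ₗ.[𝕜] H} {v : HilbertBasis ℕ 𝕜 H} {lam : ℕ → ℝ} {ρ γ T ε : ℝ}

/-- Here `f = A^(-ε) g`, and `A^(-ε)` is bounded by `lam 0 ^ (-ε)` because `lam 0` is the least
eigenvalue. -/
lemma continuousOn_of_fracPower (hlam : ∀ k, 0 < lam k) (hmono : Monotone lam) (hε : 0 < ε)
    {f g : ℝ → H} (hg : ContinuousOn g (Icc 0 T))
    (hgf : ∀ t ∈ Icc 0 T, ∀ k, inner 𝕜 (v k) (g t) = ((lam k ^ ε : ℝ) : 𝕜) * inner 𝕜 (v k) (f t)) :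
    ContinuousOn f (Icc 0 T) ∧ ∀ t ∈ Icc 0 T, ‖f t‖ ≤ lam 0 ^ (-ε) * ‖g t‖ := by
  obtain ⟨D, hD, hDn⟩ := exists_diagonal v (c := fun k => lam k ^ (-ε)) (C := lam 0 ^ (-ε))
    (fun k => by
      rw [abs_of_pos (Real.rpow_pos_of_pos (hlam k) _)]
      exact Real.rpow_le_rpow_of_nonpos (hlam 0) (hmono (Nat.zero_le k)) (by linarith))
  have heq : ∀ t ∈ Icc 0 T, f t = D (g t) := fun t ht => eq_of_inner_eq v fun k => by
    rw [hD, hgf t ht, ← mul_assoc, ← RCLike.ofReal_mul, ← Real.rpow_add (hlam k)]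
    simp
  refine ⟨(D.continuous.comp_continuousOn hg).congr heq, fun t ht => ?_⟩
  rw [heq t ht]
  exact hDn _

variable [NormedSpace ℝ H]

lemma intervalIntegrable_caputoIntegrand (hρ : ρ < 1) {u z : ℝ → H} (hz : Continuous z)
    (hu : ∀ t, deriv u t = z t) (t : ℝ) :
    IntervalIntegrable (caputoIntegrand ρ u t) volume 0 t := by
  have h1 : IntervalIntegrable (fun x : ℝ => x ^ (-ρ)) volume 0 t :=
    intervalIntegral.intervalIntegrable_rpow' (by linarith)
  have h2 := (h1.comp_sub_left t).symm
  simp only [sub_zero, sub_self] at h2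
  have h3 : caputoIntegrand ρ u t = fun ξ => (t - ξ) ^ (-ρ) • z ξ :=
    funext fun ξ => by rw [caputoIntegrand, hu]
  rw [h3]
  exact h2.smul_continuousOn hz.continuousOn

variable [IsScalarTower ℝ 𝕜 H]

lemma inner_real_smul (k : ℕ) (r : ℝ) (x : H) :
    inner 𝕜 (v k) (r • x) = (r : 𝕜) * inner 𝕜 (v k) x := by
  rw [← algebraMap_smul 𝕜 r x, inner_smul_right]

variable [CompleteSpace H]

/-- Existence of a solution with the series representation and with bounds on its terms. -/
theorem exists_forwardSolution (hA : IsSelfAdjoint A) (hlam : ∀ k, 0 < lam k) (hmono : Monotone lam)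
    (hv : ∀ k, ∃ hk : v k ∈ A.domain, A ⟨v k, hk⟩ = (lam k : 𝕜) • v k)
    (hρ : ρ ∈ Ioo (0 : ℝ) 1) (hγ : 0 < γ) (hT : 0 < T) (hε : ε ∈ Ioo (0 : ℝ) 1)
    {f g : ℝ → H} (hg : ContinuousOn g (Icc 0 T))
    (hgf : ∀ t ∈ Icc 0 T, ∀ k, inner 𝕜 (v k) (g t) = ((lam k ^ ε : ℝ) : 𝕜) * inner 𝕜 (v k) (f t))
    {c₀ c₁ c₂ : ℝ} (hc₀ : c₀ = lam 0 ^ (-ε))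
    (hc₁ : c₁ = c₀ + (T ^ ρ + γ) ^ ε * (T ^ (ε * (1 - ρ)) / (ε * (1 - ρ))))
    (hc₂ : c₂ = γ⁻¹ * (T ^ ρ / ρ) * c₀) :
    ∃ V : ℝ → H, IsForwardSolution A ρ γ T f 0 V ∧
      (∀ t ∈ Icc 0 T,
        (∀ k, IntervalIntegrable
          (fun τ => kernelB ρ γ (lam k) (t - τ) • inner 𝕜 (v k) (f τ)) volume 0 t) ∧
        HasSum (fun k => (∫ τ in (0 : ℝ)..t,
          kernelB ρ γ (lam k) (t - τ) • inner 𝕜 (v k) (f τ)) • v k) (V t)) ∧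
      (∀ t ∈ Icc 0 T, DifferentiableWithinAt ℝ V (Icc 0 T) t ∧ V t ∈ A.domain ∧
        caputo ρ V t ∈ A.domain) ∧
      ∀ S, (∀ t ∈ Icc 0 T, ‖g t‖ ≤ S) → ∀ t ∈ Icc 0 T,
        ‖timeDeriv T V t‖ ≤ c₁ * S ∧ ‖opApply A (V t)‖ ≤ c₂ * S ∧
        ‖opApply A (caputo ρ V t)‖ ≤ γ⁻¹ * (c₀ + c₁ + c₂) * S := by
  have hδ : 0 < ε * (1 - ρ) := mul_pos hε.1 (sub_pos.2 hρ.2)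
  obtain ⟨hf, hfg⟩ := continuousOn_of_fracPower hlam hmono hε.1 hg hgf
  rw [← hc₀] at hfg
  -- `W` is `D*f`, written as the kernel `A^(-ε) D` acting on `g = A^ε f`; `Y` below is the kernel
  -- `AB` acting on `f` and will be `AV`.
  obtain ⟨W, hWc, hWk, hWb⟩ := exists_diagonal_volterra v
    (m := fun k t => lam k ^ (-ε) * kernelD ρ γ (lam k) t) (fun k => by fun_prop) hδ hT.le
    (fun k t ht => by
      rw [abs_of_nonneg (mul_nonneg (Real.rpow_nonneg (hlam k).le _)
        (kernelD_nonneg hρ hγ (hlam k) t))]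
      exact kernelD_le_rpow hρ hγ (hlam k) hε ht.1 ht.2) hg
  obtain ⟨Y, hYc, hYk, hYb⟩ := exists_diagonal_volterra v
    (m := fun k t => lam k * kernelB ρ γ (lam k) t) (fun k => by fun_prop) hρ.1 hT.le
    (fun k t ht => by
      rw [abs_of_nonneg (mul_nonneg (hlam k).le (kernelB_nonneg hρ hγ (hlam k) t))]
      exact kernelB_le_rpow hρ hγ (hlam k) ht.1) hf
  -- A continuous extension to the line, so that its primitive `V` has a two-sided derivative
  -- everywhere, also at `0` and `T`.
  obtain ⟨Z, hZ, hZeq⟩ : ∃ Z : ℝ → H, Continuous Z ∧ ∀ t ∈ Icc 0 T, Z t = f t - W t :=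
    ⟨IccExtend hT.le ((Icc 0 T).domRestrict fun t => f t - W t),
      (continuousOn_iff_continuous_domRestrict.1 (hf.sub hWc)).Icc_extend',
      fun t ht => IccExtend_of_mem hT.le _ ht⟩
  have hinner : ∀ {h : ℝ → H}, ContinuousOn h (Icc 0 T) → ∀ k,
      ContinuousOn (fun t => inner 𝕜 (v k) (h t)) (Icc 0 T) := fun hh k =>
    (coeffCLM v k).continuous.comp_continuousOn hh
  have hscal := fun k => scalar_solution hρ hγ (hlam k) hT.le (hinner hf k)
    (hinner hZ.continuousOn k) (fun t ht => by
      rw [hZeq t ht, inner_sub_right, hWk t ht k]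
      congr 1
      refine intervalIntegral.integral_congr fun τ hτ => ?_
      rw [uIcc_of_le ht.1] at hτ
      simp only [hgf τ ⟨hτ.1, hτ.2.trans ht.2⟩ k, RCLike.real_smul_eq_coe_mul]
      rw [mul_comm (lam k ^ (-ε)), RCLike.ofReal_mul, mul_assoc, ← mul_assoc (_ : 𝕜) _ (inner 𝕜 _ _),
        ← RCLike.ofReal_mul, ← Real.rpow_add (hlam k)]
      simp)
  set V : ℝ → H := fun t => ∫ τ in (0 : ℝ)..t, Z τ with hV
  have hVd : ∀ t, HasDerivAt V (Z t) t := fun t =>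
    intervalIntegral.integral_hasDerivAt_right (hZ.intervalIntegrable _ _)
      (hZ.stronglyMeasurableAtFilter _ _) hZ.continuousAt
  have hVt : ∀ t ∈ Icc 0 T, timeDeriv T V t = Z t := fun t ht =>
    (hVd t).hasDerivWithinAt.derivWithin (uniqueDiffOn_Icc hT t ht)
  have hVk : ∀ t ∈ Icc 0 T, ∀ k, inner 𝕜 (v k) (V t) =
      volterra (kernelB ρ γ (lam k)) (fun τ => inner 𝕜 (v k) (f τ)) t := by
    intro t ht k
    rw [← (hscal k t ht).1, ← coeffCLM_apply, hV,
      ← ContinuousLinearMap.intervalIntegral_comp_comm _ (hZ.intervalIntegrable _ _)]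
    rfl
  have hcapi : ∀ t, IntervalIntegrable (caputoIntegrand ρ V t) volume 0 t :=
    intervalIntegrable_caputoIntegrand hρ.2 hZ fun t => (hVd t).deriv
  have hcapk : ∀ t ∈ Icc 0 T, ∀ k, inner 𝕜 (v k) (caputo ρ V t) =
      volterra (caputoKernel ρ) (fun τ => inner 𝕜 (v k) (Z τ)) t := fun t ht k =>
    inner_caputo (hcapi t) ht.1 (fun ξ _ => (hVd ξ).deriv) k
  -- The value that the equation forces on `A D^ρ V`; its continuity and bound come from those of
  -- the other terms.
  set X : ℝ → H := fun t => γ⁻¹ • (f t - Z t - Y t) with hX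
  have hY' : ∀ t ∈ Icc 0 T, ∀ k, inner 𝕜 (v k) (Y t) = (lam k : 𝕜) * inner 𝕜 (v k) (V t) := by
    intro t ht k
    rw [hYk t ht k, volterra_const_mul_left, ← hVk t ht k, RCLike.real_smul_eq_coe_mul]
  have hX' : ∀ t ∈ Icc 0 T, ∀ k,
      inner 𝕜 (v k) (X t) = (lam k : 𝕜) * inner 𝕜 (v k) (caputo ρ V t) := by
    intro t ht k
    have h1 := (hscal k t ht).2
    rw [(hscal k t ht).1, ← hVk t ht k, ← hcapk t ht k] at h1
    simp only [RCLike.real_smul_eq_coe_mul] at h1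
    have hγ' : (γ : 𝕜) ≠ 0 := by exact_mod_cast hγ.ne'
    rw [hX, inner_real_smul, inner_sub_right, inner_sub_right, hY' t ht k, ← h1]
    push_cast
    field_simp
    ring
  have hAV := fun t ht => opApply_eq_of_inner_eq hA hv (hY' t ht)
  have hAC := fun t ht => opApply_eq_of_inner_eq hA hv (hX' t ht)
  have hXc : ContinuousOn X (Icc 0 T) := ((hf.sub hZ.continuousOn).sub hYc).const_smul _
  refine ⟨V, ?_, ?_, ?_, ?_⟩
  · refine
      { continuousOn := fun t _ => (hVd t).continuousAt.continuousWithinAt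
        differentiable := fun t _ => (hVd t).differentiableAt.differentiableWithinAt
        continuousOn_timeDeriv := hZ.continuousOn.congr fun t ht => hVt t (Ioc_subset_Icc_self ht)
        mem_domain := fun t ht => (hAV t (Ioc_subset_Icc_self ht)).1
        continuousOn_op := (hYc.mono Ioc_subset_Icc_self).congr
          fun t ht => (hAV t (Ioc_subset_Icc_self ht)).2
        caputo_exists := fun t _ => hcapi t
        caputo_mem_domain := fun t ht => (hAC t (Ioc_subset_Icc_self ht)).1
        continuousOn_op_caputo := (hXc.mono Ioc_subset_Icc_self).congr
          fun t ht => (hAC t (Ioc_subset_Icc_self ht)).2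
        equation := fun t ht => ?_
        initial := intervalIntegral.integral_same }
    have ht' := Ioc_subset_Icc_self ht
    have h2 : opApply A (V t + γ • caputo ρ V t) = Y t + γ • X t :=
      (opApply_eq_of_inner_eq hA hv fun k => by
        rw [inner_add_right, inner_add_right, inner_real_smul k γ (X t),
          inner_real_smul k γ (caputo ρ V t), hY' t ht' k,
          hX' t ht' k]
        ring).2
    rw [h2, hVt t ht', hX, smul_smul, mul_inv_cancel₀ hγ.ne', one_smul]
    abel
  · intro t ht
    refine ⟨fun k => intervalIntegrable_volterra ht (integrableOn_kernelB hρ hγ (hlam k))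
      (hinner hf k), ?_⟩
    have h := v.hasSum_repr (V t)
    simp only [v.repr_apply_apply, hVk t ht] at h
    exact h
  · exact fun t ht => ⟨(hVd t).differentiableAt.differentiableWithinAt, (hAV t ht).1, (hAC t ht).1⟩
  · intro S hS t ht
    have hc₀0 : 0 ≤ c₀ := hc₀ ▸ Real.rpow_nonneg (hlam 0).le _
    have bf : ∀ s ∈ Icc 0 T, ‖f s‖ ≤ c₀ * S := fun s hs =>
      (hfg s hs).trans (mul_le_mul_of_nonneg_left (hS s hs) hc₀0)
    have bZ : ‖Z t‖ ≤ c₁ * S := by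
      rw [hZeq t ht, hc₁, add_mul]
      exact (norm_sub_le _ _).trans (add_le_add (bf t ht) (hWb S hS t ht))
    have bY : ‖Y t‖ ≤ c₂ * S := (hYb _ bf t ht).trans_eq (by rw [hc₂]; ring)
    refine ⟨by rwa [hVt t ht], by rwa [(hAV t ht).2], ?_⟩
    rw [(hAC t ht).2, hX, norm_smul, Real.norm_of_nonneg (inv_pos.2 hγ).le, mul_assoc]
    refine mul_le_mul_of_nonneg_left ?_ (inv_pos.2 hγ).le
    calc ‖f t - Z t - Y t‖ ≤ ‖f t‖ + ‖Z t‖ + ‖Y t‖ :=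
          (norm_sub_le _ _).trans (add_le_add_left (norm_sub_le _ _) _)
      _ ≤ c₀ * S + c₁ * S + c₂ * S := add_le_add (add_le_add (bf t ht) bZ) bY
      _ = (c₀ + c₁ + c₂) * S := by ring

end Existence

end RayleighStokes

theorem theorem4p1 {𝕜 : Type*} [RCLike 𝕜] {H : Type*} [NormedAddCommGroup H]
    [InnerProductSpace 𝕜 H] [CompleteSpace H] [NormedSpace ℝ H] [IsScalarTower ℝ 𝕜 H]
    (A : H →ₗ.[𝕜] H) (hA : IsSelfAdjoint A)
    (v : HilbertBasis ℕ 𝕜 H) (lam : ℕ → ℝ)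
    (hlam_pos : ∀ k, 0 < lam k) (hlam_mono : Monotone lam) (hlam_top : Tendsto lam atTop atTop)
    (hv : ∀ k, ∃ hk : v k ∈ A.domain, A ⟨v k, hk⟩ = (lam k : 𝕜) • v k)
    (ρ : ℝ) (hρ : ρ ∈ Ioo (0 : ℝ) 1) (γ : ℝ) (hγ : 0 < γ) (T : ℝ) (hT : 0 < T)
    (ε : ℝ) (hε : ε ∈ Ioo (0 : ℝ) 1) :
    ∃ C : ℝ, 0 < C ∧ ∀ f : ℝ → H, RayleighStokes.FracContinuous v lam ε T f →
      ∃ V : ℝ → H,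
        -- existence
        RayleighStokes.IsForwardSolution A ρ γ T f 0 V ∧
        -- uniqueness on [0, T]
        (∀ U : ℝ → H, RayleighStokes.IsForwardSolution A ρ γ T f 0 U → EqOn U V (Icc 0 T)) ∧
        -- the series representation
        (∀ t ∈ Icc 0 T,
          (∀ k, IntervalIntegrable
            (fun τ => RayleighStokes.kernelB ρ γ (lam k) (t - τ) • inner 𝕜 (v k) (f τ))
            volume 0 t) ∧
          HasSum (fun k =>
            (∫ τ in (0 : ℝ)..t,
              RayleighStokes.kernelB ρ γ (lam k) (t - τ) • inner 𝕜 (v k) (f τ)) • v k) (V t)) ∧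
        -- the terms of the estimate are defined at every t in [0, T], also at t = 0
        (∀ t ∈ Icc 0 T, DifferentiableWithinAt ℝ V (Icc 0 T) t ∧ V t ∈ A.domain ∧
          RayleighStokes.caputo ρ V t ∈ A.domain) ∧
        -- the coercive estimate, where M is the maximum of the squared norm of f over [0, T]
        ∃ M : ℝ, IsGreatest ((fun s => RayleighStokes.fracNorm v lam ε (f s) ^ 2) '' Icc 0 T) M ∧
          ∀ t ∈ Icc 0 T,
            ‖RayleighStokes.timeDeriv T V t‖ ^ 2 + ‖RayleighStokes.opApply A (V t)‖ ^ 2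
              + ‖RayleighStokes.opApply A (RayleighStokes.caputo ρ V t)‖ ^ 2 ≤ C * M := by
  -- In units of the maximum of `‖A^ε f‖`, `c₀` bounds `f`, `c₁` bounds `V'` and `c₂` bounds `AV`;
  -- the fractions are the integrals over `(0, T)` of the two singular powers.
  set c₀ := lam 0 ^ (-ε) with hc₀
  set c₁ := c₀ + (T ^ ρ + γ) ^ ε * (T ^ (ε * (1 - ρ)) / (ε * (1 - ρ))) with hc₁
  set c₂ := γ⁻¹ * (T ^ ρ / ρ) * c₀ with hc₂
  have hc₀0 : 0 < c₀ := Real.rpow_pos_of_pos (hlam_pos 0) _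
  have hc₁0 : 0 < c₁ := by
    have h1 : 0 < ε * (1 - ρ) := mul_pos hε.1 (sub_pos.2 hρ.2)
    positivity
  refine ⟨c₁ ^ 2 + c₂ ^ 2 + (γ⁻¹ * (c₀ + c₁ + c₂)) ^ 2, by positivity, fun f hf => ?_⟩
  obtain ⟨g, hg, hgf, hgn⟩ := RayleighStokes.exists_fracPower hlam_pos hf
  obtain ⟨V, hV, hser, hdom, hbound⟩ := RayleighStokes.exists_forwardSolution hA hlam_pos
    hlam_mono hv hρ hγ hT hε hg hgf hc₀ hc₁ hc₂
  refine ⟨V, hV, fun U hU => hU.eqOn hA hlam_pos hv hρ hγ hT hV, hser, hdom, ?_⟩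
  obtain ⟨s, hs, hmax⟩ := isCompact_Icc.exists_isMaxOn (nonempty_Icc.2 hT.le) hg.norm
  have hle : ∀ t ∈ Icc 0 T, ‖g t‖ ≤ ‖g s‖ := fun t ht => hmax ht
  refine ⟨‖g s‖ ^ 2, ⟨⟨s, hs, by simp only [hgn s hs]⟩, ?_⟩, fun t ht => ?_⟩
  · rintro _ ⟨t, ht, rfl⟩
    simp only [hgn t ht]
    exact pow_le_pow_left₀ (norm_nonneg _) (hle t ht) 2
  · obtain ⟨h1, h2, h3⟩ := hbound _ hle t ht
    have e1 := pow_le_pow_left₀ (norm_nonneg _) h1 2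
    have e2 := pow_le_pow_left₀ (norm_nonneg _) h2 2
    have e3 := pow_le_pow_left₀ (norm_nonneg _) h3 2
    rw [mul_pow] at e1 e2 e3
    linarith
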